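/- Graphs are undirected, without loops or multiple edges, and have a non-empty vertex set. For a positive integer $k$, a graph $G$ has the $k$-extension property if for all non-negative integers $a,b$ with $a+b=k$ and all vertices $v_1,\dots,v_a,u_1,\dots,u_b$ of $G$ (repetitions allowed) with $v_i\neq u_j$ for all $i,j$, there is a vertex $z$ adjacent to every $v_i$ and, for every $j$, different from and not adjacent to $u_j$. Let $\mathcal{E}_1^2$ be the class of sentences $\exists X\,\phi(X)$, where $X$ is a single variable for a set of vertices and $\phi(X)$ is a first order sentence of quantifier depth at most $2$ over adjacency, equality and the unary predicate $X$. A sentence does not differ between $G$ and $H$ if it is true on both or false on both. For a set $X$ of vertices let $\mathrm{cl}(X)$ say that $X$ is a clique (any two distinct vertices of $X$ are adjacent), let $\max\mathrm{cl}(X)$ say that moreover no vertex outside $X$ is adjacent to all vertices of $X$, and let $\varphi_C(X)$ say that some vertex outside $X$ is adjacent to no vertex of $X$. Let $\mathrm{ind}(X)$ say that $X$ is an independent set (no two vertices of $X$ are adjacent), let $\max\mathrm{ind}(X)$ say that moreover every vertex outside $X$ is adjacent to some vertex of $X$, and let $\varphi_I(X)$ say that some vertex outside $X$ is adjacent to all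 vertices of $X$. Put $$\varphi^1_C=\forall X\,[\mathrm{cl}(X)\to\varphi_C(X)],\quad \varphi^2_C=\forall X\,[\max\mathrm{cl}(X)\to\neg\varphi_C(X)],\quad \varphi^3_C=\forall X\,[(\mathrm{cl}(X)\wedge\neg\varphi_C(X))\to\max\mathrm{cl}(X)],$$ $$\varphi^1_I=\forall X\,[\mathrm{ind}(X)\to\varphi_I(X)],\quad \varphi^2_I=\forall X\,[\max\mathrm{ind}(X)\to\neg\varphi_I(X)],\quad \varphi^3_I=\forall X\,[(\mathrm{ind}(X)\wedge\neg\varphi_I(X))\to\max\mathrm{ind}(X)].$$ Theorem. (1) There is a positive integer $s$ such that, if graphs $G$ and $H$ (finite or infinite) have the $s$-extension property and none of $\varphi^1_C,\varphi^2_C,\varphi^3_C,\varphi^1_I,\varphi^2_I,\varphi^3_I$ differs between $G$ and $H$, then no sentence of $\mathcal{E}_1^2$ differs between $G$ and $H$. (2) The set of these six sentences is minimal in the following sense. For every positive integer $s$, for $Q\in\{C,I\}$, and for every $$\varphi\in\{\varphi^1_Q,\ \neg\varphi^1_Q\wedge\neg\varphi^2_Q\wedge\varphi^3_Q,\ \neg\varphi^1_Q\wedge\neg\varphi^2_Q\wedge\neg\varphi^3_Q,\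 \varphi^2_Q\wedge\varphi^3_Q,\ \varphi^2_Q\wedge\neg\varphi^3_Q\},$$ there is a finite graph $G$ with the $s$-extension property such that $G\models\varphi$. -/

import Mathlib

namespace MonadicGraph

universe u

open FirstOrder

/-! ### The class of sentences `∃ X, φ(X)` with `φ` first order of quantifier depth at most two -/

/-- Relation symbols: adjacency (binary) and the monadic predicate `X` (unary). -/
inductive GraphSetRel : ℕ → Type
  | adj : GraphSetRel 2
  | mem : GraphSetRel 1

/-- The first order language of graphs with one additional unary predicate `X`. -/
def graphSetLanguage : Language := ⟨fun _ => Empty, GraphSetRel⟩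

/-- A graph `G` with a set `X` of vertices, as a first order structure. -/
@[reducible]
def graphSetStructure {V : Type u} (G : SimpleGraph V) (X : Set V) :
    graphSetLanguage.Structure V where
  funMap := fun f _ => Empty.elim f
  RelMap := fun r =>
    match r with
    | .adj => fun x => G.Adj (x 0) (x 1)
    | .mem => fun x => x 0 ∈ X

/-- Quantifier depth. In Mathlib's syntax `¬`, `∧`, `∨`, `↔` and `∃` are abbreviations built
from `⊥`, `→` and `∀`, with `∃ x, φ` standing for `¬ ∀ x, ¬ φ`, so that each `∃` counts once. -/
def quantifierDepth {L : Language} {α : Type} : {n : ℕ} → L.BoundedFormula α n → ℕ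
  | _, .falsum => 0
  | _, .equal _ _ => 0
  | _, .rel _ _ => 0
  | _, .imp φ ψ => max (quantifierDepth φ) (quantifierDepth ψ)
  | _, .all φ => quantifierDepth φ + 1

/-- An existential monadic second order sentence `∃ X, φ(X)` with a single monadic variable `X`,
where `φ` is a first order sentence of quantifier depth at most two. -/
structure E12Sentence where
  /-- The first order part `φ(X)`. -/
  firstOrderPart : graphSetLanguage.Sentence
  depth_le : quantifierDepth firstOrderPart ≤ 2

/-- `G ⊨ ∃ X, φ(X)`. -/
def E12Sentence.Holds {V : Type u} (Ψ : E12Sentence) (G : SimpleGraph V) : Prop :=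
  ∃ X : Set V, @Language.Sentence.Realize graphSetLanguage V (graphSetStructure G X)
    Ψ.firstOrderPart

/-! ### The extension property -/

/-- The `k`-extension property of `G`. The `v i` need not be distinct, nor need the `w j`. -/
def ExtensionProperty {V : Type u} (k : ℕ) (G : SimpleGraph V) : Prop :=
  ∀ a b : ℕ, a + b = k → ∀ (v : Fin a → V) (w : Fin b → V), (∀ i j, v i ≠ w j) →
    ∃ z : V, (∀ i, G.Adj z (v i)) ∧ ∀ j, ¬ G.Adj z (w j) ∧ z ≠ w j

/-! ### The six monadic sentences -/

section Sentences

variable {V : Type u} (G : SimpleGraph V)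

/-- `X` is a maximal clique: a clique without an external vertex adjacent to all of `X`. -/
def MaxClique (X : Set V) : Prop :=
  G.IsClique X ∧ ¬ ∃ x, x ∉ X ∧ ∀ y ∈ X, G.Adj x y

/-- Some external vertex is not adjacent to any vertex of `X`. -/
def ExtNonAdj (X : Set V) : Prop :=
  ∃ x, x ∉ X ∧ ∀ y ∈ X, ¬ G.Adj x y

/-- `X` is a maximal independent set: an independent set such that every external vertex is
adjacent to some vertex of `X`. -/
def MaxIndep (X : Set V) : Prop :=
  G.IsIndepSet X ∧ ¬ ∃ x, x ∉ X ∧ ∀ y ∈ X, ¬ G.Adj x y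

/-- Some external vertex is adjacent to all vertices of `X`. -/
def ExtAdj (X : Set V) : Prop :=
  ∃ x, x ∉ X ∧ ∀ y ∈ X, G.Adj x y

def PhiC1 : Prop := ∀ X : Set V, G.IsClique X → ExtNonAdj G X

def PhiC2 : Prop := ∀ X : Set V, MaxClique G X → ¬ ExtNonAdj G X

def PhiC3 : Prop := ∀ X : Set V, G.IsClique X ∧ ¬ ExtNonAdj G X → MaxClique G X

def PhiI1 : Prop := ∀ X : Set V, G.IsIndepSet X → ExtAdj G X

def PhiI2 : Prop := ∀ X : Set V, MaxIndep G X → ¬ ExtAdj G X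

def PhiI3 : Prop := ∀ X : Set V, G.IsIndepSet X ∧ ¬ ExtAdj G X → MaxIndep G X

/-- The five possible combinations of truth values of three sentences `p₁, p₂, p₃` such that
`p₁` implies `p₃` and `p₂` implies `¬ p₁`. -/
def FiveCases (p₁ p₂ p₃ : Prop) : Fin 5 → Prop :=
  ![p₁, ¬ p₁ ∧ ¬ p₂ ∧ p₃, ¬ p₁ ∧ ¬ p₂ ∧ ¬ p₃, p₂ ∧ p₃, p₂ ∧ ¬ p₃]

end Sentences

end MonadicGraph

/-! Part (1). Two rounds of the Ehrenfeucht–Fraïssé game see only the set of depth one types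
("profiles") occurring in a graph with a set `X`. So it suffices to find, for each `X` in `G`, a set
`Y` in `H` with the same profiles (`exists_profiles_eq`); the converse is symmetric.

If some vertex fails to see some kind of member of `X`, and some vertex fails to see some kind of
non-member, the extension property forces the two vertices to coincide, and off that vertex `X` is
its set of neighbours or of non-neighbours. Otherwise, after complementing `X` if necessary, every
vertex sees both kinds of non-members. If some vertex sees no member, `X` has at most one element.
If not, each vertex misses at most one kind of member. When some member misses nothing, only twelve
profile sets remain, each realized in `H` by an explicit `Shape` with at most three parameters. When
every member misses something, `X` is a clique or an independent set with at least two elements. The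
profiles of such a clique depend only on `ExtNonAdj` and `ExtAdj`; having both is always possible,
and the other three combinations are governed by the three sentences on cliques. Complementing the
graph settles independent sets.

Part (2). Some adjacencies between finitely many classes are prescribed and the others are random; a
union bound makes all small free patterns occur (`exists_isGeneric`). All parts are independent, so
cliques are small, and a clique has an external vertex adjacent to all, or to none, of its members
as soon as some class has no prescription against it. With only the classes prescribed, no clique
dominates, which gives `PhiC1`. In the other examples each ground vertex is dominated by one part of
the dominators, so that a dominating clique must be a transversal of these parts. Labels on the
dominators make it meet every ground part too, hence be maximal (`PhiC3`); without labels a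
transversal dominates but is not maximal. Extra vertices lie in no transversal and so produce
maximal cliques that do not dominate, refuting `PhiC2`. -/

namespace MonadicGraph

universe u v

open FirstOrder

/-! ### Depth two equivalence of graphs with a set of vertices -/

section EhrenfeuchtFraisse

variable {V : Type u} {W : Type v}

/-- The tuples `x` and `y` satisfy the same atomic formulas. -/
def SameAtoms (G : SimpleGraph V) (X : Set V) (H : SimpleGraph W) (Y : Set W) {n : ℕ}
    (x : Fin n → V) (y : Fin n → W) : Prop :=
  (∀ i j, x i = x j ↔ y i = y j) ∧ (∀ i j, G.Adj (x i) (x j) ↔ H.Adj (y i) (y j)) ∧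
    ∀ i, x i ∈ X ↔ y i ∈ Y

/-- Duplicator wins the Ehrenfeucht–Fraïssé game with `k` rounds from the tuples `x` and `y`. -/
def BackAndForth (G : SimpleGraph V) (X : Set V) (H : SimpleGraph W) (Y : Set W) :
    ℕ → {n : ℕ} → (Fin n → V) → (Fin n → W) → Prop
  | 0, _, x, y => SameAtoms G X H Y x y
  | k + 1, _, x, y => SameAtoms G X H Y x y ∧
      (∀ p, ∃ q, BackAndForth G X H Y k (Fin.snoc x p : Fin (_ + 1) → V)
        (Fin.snoc y q : Fin (_ + 1) → W)) ∧
      ∀ q, ∃ p, BackAndForth G X H Y k (Fin.snoc x p : Fin (_ + 1) → V)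
        (Fin.snoc y q : Fin (_ + 1) → W)

theorem BackAndForth.sameAtoms {G : SimpleGraph V} {X : Set V} {H : SimpleGraph W} {Y : Set W}
    {k n : ℕ} {x : Fin n → V} {y : Fin n → W} (h : BackAndForth G X H Y k x y) :
    SameAtoms G X H Y x y := by
  cases k with
  | zero => exact h
  | succ k => exact h.1

theorem exists_term_eq_var {n : ℕ} (t : graphSetLanguage.Term (Empty ⊕ Fin n)) :
    ∃ i : Fin n, t = Language.Term.var (Sum.inr i) := by
  cases t with
  | var a =>
    rcases a with a | i
    · exact a.elim
    · exact ⟨i, rfl⟩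
  | func f _ => exact Empty.elim f

theorem BackAndForth.realize_iff {G : SimpleGraph V} {X : Set V} {H : SimpleGraph W} {Y : Set W}
    {n : ℕ} (φ : graphSetLanguage.BoundedFormula Empty n) :
    ∀ {k : ℕ} {x : Fin n → V} {y : Fin n → W}, quantifierDepth φ ≤ k →
      BackAndForth G X H Y k x y →
      (@Language.BoundedFormula.Realize _ V (graphSetStructure G X) _ _ φ default x ↔
        @Language.BoundedFormula.Realize _ W (graphSetStructure H Y) _ _ φ default y) := by
  induction φ with
  | falsum => intros; exact Iff.rfl
  | equal t₁ t₂ =>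
    intro k x y _ h
    obtain ⟨i, rfl⟩ := exists_term_eq_var t₁
    obtain ⟨j, rfl⟩ := exists_term_eq_var t₂
    exact h.sameAtoms.1 i j
  | rel r ts =>
    intro k x y _ h
    cases r with
    | adj =>
      obtain ⟨i, hi⟩ := exists_term_eq_var (ts 0)
      obtain ⟨j, hj⟩ := exists_term_eq_var (ts 1)
      have := h.sameAtoms.2.1 i j
      simp only [Language.BoundedFormula.Realize, Language.Structure.RelMap, hi, hj]
      exact this
    | mem =>
      obtain ⟨i, hi⟩ := exists_term_eq_var (ts 0)
      have := h.sameAtoms.2.2 i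
      simp only [Language.BoundedFormula.Realize, Language.Structure.RelMap, hi]
      exact this
  | imp φ ψ ihφ ihψ =>
    intro k x y hk h
    simp only [quantifierDepth, max_le_iff] at hk
    exact imp_congr (ihφ hk.1 h) (ihψ hk.2 h)
  | all φ ih =>
    intro k x y hk h
    cases k with
    | zero => simp [quantifierDepth] at hk
    | succ k =>
      have hk' : quantifierDepth φ ≤ k := by simpa [quantifierDepth] using hk
      constructor
      · intro hx q
        obtain ⟨p, hp⟩ := h.2.2 q
        exact (ih hk' hp).1 (hx p)
      · intro hy p
        obtain ⟨q, hq⟩ := h.2.1 p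
        exact (ih hk' hq).2 (hy q)

end EhrenfeuchtFraisse

/-! ### Profiles of vertices -/

/-- The depth one type of a vertex `x` in a graph with a set `X`: whether `x ∈ X`, and, for truth
values `m` and `a`, whether some `z ≠ x` has membership in `X` given by `m` and adjacency to `x`
given by `a`. -/
abbrev Profile : Type := Bool × (Bool → Bool → Bool)

section Profiles

variable {V : Type u} {W : Type v}

/-- Some `z ≠ x` has membership in `X` given by `m` and adjacency to `x` given by `a`. -/
def Sees (G : SimpleGraph V) (X : Set V) (x : V) (m a : Bool) : Prop :=
  ∃ z, z ≠ x ∧ (z ∈ X ↔ m = true) ∧ (G.Adj x z ↔ a = true)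

open Classical in
/-- The profile of a vertex. -/
noncomputable def profile (G : SimpleGraph V) (X : Set V) (x : V) : Profile :=
  (decide (x ∈ X), fun m a => decide (Sees G X x m a))

/-- The set of profiles of all vertices. -/
def profiles (G : SimpleGraph V) (X : Set V) : Set Profile := Set.range (profile G X)

theorem profile_eq_iff {G : SimpleGraph V} {X : Set V} {x : V} {t : Profile} :
    profile G X x = t ↔ (x ∈ X ↔ t.1 = true) ∧ ∀ m a, Sees G X x m a ↔ t.2 m a = true := by
  obtain ⟨b, g⟩ := t
  simp only [profile, Prod.mk.injEq, funext_iff]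
  refine and_congr ?_ (forall_congr' fun m => forall_congr' fun a => ?_)
  · cases b <;> simp
  · cases g m a <;> simp

theorem backAndForth_one_of_profile_eq {G : SimpleGraph V} {X : Set V} {H : SimpleGraph W}
    {Y : Set W} {x : V} {y : W} (h : profile G X x = profile H Y y) :
    BackAndForth G X H Y 1 (fun _ : Fin 1 => x) (fun _ : Fin 1 => y) := by
  have h' := profile_eq_iff.1 h
  have hxy : x ∈ X ↔ y ∈ Y := by simpa [profile] using h'.1
  have hs : ∀ m a, Sees G X x m a ↔ Sees H Y y m a := by simpa [profile] using h'.2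
  refine ⟨⟨by simp, by simp, fun _ => hxy⟩, fun p => ?_, fun q => ?_⟩
  · by_cases hp : p = x
    · subst hp
      exact ⟨y, by simp [Fin.snoc], by simp [Fin.snoc], by simp [Fin.snoc, hxy]⟩
    · classical
      obtain ⟨q, hq, hm, ha⟩ :=
        (hs (decide (p ∈ X)) (decide (G.Adj x p))).1 ⟨p, hp, by simp, by simp⟩
      simp only [decide_eq_true_eq] at hm ha
      refine ⟨q, ?_, ?_, ?_⟩
      · simp [Fin.forall_fin_two, Fin.snoc, hp, hq, Ne.symm hp, Ne.symm hq]
      · simp [Fin.forall_fin_two, Fin.snoc, ha, G.adj_comm p x, H.adj_comm q y]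
      · simp [Fin.forall_fin_two, Fin.snoc, hm, hxy]
  · by_cases hq : q = y
    · subst hq
      exact ⟨x, by simp [Fin.snoc], by simp [Fin.snoc], by simp [Fin.snoc, hxy]⟩
    · classical
      obtain ⟨p, hp, hm, ha⟩ :=
        (hs (decide (q ∈ Y)) (decide (H.Adj y q))).2 ⟨q, hq, by simp, by simp⟩
      simp only [decide_eq_true_eq] at hm ha
      refine ⟨p, ?_, ?_, ?_⟩
      · simp [Fin.forall_fin_two, Fin.snoc, hp, hq, Ne.symm hp, Ne.symm hq]
      · simp [Fin.forall_fin_two, Fin.snoc, ha, G.adj_comm p x, H.adj_comm q y]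
      · simp [Fin.forall_fin_two, Fin.snoc, hm, hxy]

/-- Duplicator answers the first move by a vertex of equal profile; the profile then lists the
answers available to the second. -/
theorem realize_iff_of_profiles_eq {G : SimpleGraph V} {X : Set V} {H : SimpleGraph W} {Y : Set W}
    (h : profiles G X = profiles H Y) (φ : graphSetLanguage.Sentence)
    (hφ : quantifierDepth φ ≤ 2) :
    @Language.Sentence.Realize graphSetLanguage V (graphSetStructure G X) φ ↔
      @Language.Sentence.Realize graphSetLanguage W (graphSetStructure H Y) φ := by
  have key : BackAndForth G X H Y 2 (default : Fin 0 → V) (default : Fin 0 → W) := by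
    refine ⟨⟨fun i => i.elim0, fun i => i.elim0, fun i => i.elim0⟩, fun p => ?_, fun q => ?_⟩
    · obtain ⟨q, hq⟩ : profile G X p ∈ profiles H Y := h ▸ ⟨p, rfl⟩
      refine ⟨q, ?_⟩
      convert backAndForth_one_of_profile_eq hq.symm using 1 <;>
      · funext i
        simp [Fin.snoc]
    · obtain ⟨p, hp⟩ : profile H Y q ∈ profiles G X := h ▸ ⟨q, rfl⟩
      refine ⟨p, ?_⟩
      convert backAndForth_one_of_profile_eq hp using 1 <;>
      · funext i
        simp [Fin.snoc]
  exact BackAndForth.realize_iff φ hφ key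

theorem E12Sentence.Holds.of_forall_exists_profiles_eq {G : SimpleGraph V} {H : SimpleGraph W}
    (h : ∀ X : Set V, ∃ Y : Set W, profiles G X = profiles H Y) {Ψ : E12Sentence}
    (hΨ : Ψ.Holds G) : Ψ.Holds H := by
  obtain ⟨X, hX⟩ := hΨ
  obtain ⟨Y, hY⟩ := h X
  exact ⟨Y, (realize_iff_of_profiles_eq hY _ Ψ.depth_le).1 hX⟩

end Profiles

/-! ### Consequences of the extension property -/

section Extension

variable {V : Type u} {G : SimpleGraph V} {s : ℕ}

theorem ExtensionProperty.exists_pattern [Nonempty V] (hG : ExtensionProperty s G) (S : Finset V)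
    (hS : S.card ≤ s) (p : V → Prop) : ∃ z, z ∉ S ∧ ∀ v ∈ S, (G.Adj z v ↔ p v) := by
  classical
  rcases S.eq_empty_or_nonempty with rfl | hne
  · exact ⟨Classical.arbitrary V, by simp⟩
  have : Nonempty S := hne.to_subtype
  obtain ⟨f⟩ : Nonempty (S ↪ Fin s) :=
    Function.Embedding.nonempty_of_card_le (by simpa using hS)
  have hsurj := Function.invFun_surjective f.injective
  -- The extension property needs exactly `s` vertices, so `S` is enumerated with repetitions by a
  -- surjection from `Fin s`.
  set g : Fin s → S := Function.invFun f
  let eP := Fintype.equivFin {i : Fin s // p (g i)}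
  let eN := Fintype.equivFin {i : Fin s // ¬ p (g i)}
  obtain ⟨z, hz, hz'⟩ := hG (Fintype.card {i : Fin s // p (g i)})
    (Fintype.card {i : Fin s // ¬ p (g i)})
    (by
      have h := Fintype.card_subtype_compl (fun i : Fin s => p (g i))
      have h' := Fintype.card_subtype_le (fun i : Fin s => p (g i))
      simp only [Fintype.card_fin] at h h'
      omega)
    (fun i => (g (eP.symm i)).1) (fun j => (g (eN.symm j)).1)
    (fun i j h => (eN.symm j).2 (h ▸ (eP.symm i).2))
  have hpos : ∀ v : S, p v → G.Adj z v := by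
    intro v hv
    obtain ⟨i, rfl⟩ := hsurj v
    simpa using hz (eP ⟨i, hv⟩)
  have hneg : ∀ v : S, ¬ p v → ¬ G.Adj z v ∧ z ≠ v := by
    intro v hv
    obtain ⟨i, rfl⟩ := hsurj v
    simpa using hz' (eN ⟨i, hv⟩)
  refine ⟨z, fun hzS => ?_, fun v hv => ?_⟩
  · by_cases h : p z
    · exact G.loopless.irrefl z (hpos ⟨z, hzS⟩ h)
    · exact (hneg ⟨z, hzS⟩ h).2 rfl
  · by_cases h : p v
    · exact iff_of_true (hpos ⟨v, hv⟩ h) h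
    · exact iff_of_false (hneg ⟨v, hv⟩ h).1 h

theorem extensionProperty_of_exists_pattern
    (h : ∀ S : Finset V, S.card ≤ s → ∀ p : V → Prop, ∃ z, z ∉ S ∧ ∀ v ∈ S, (G.Adj z v ↔ p v)) :
    ExtensionProperty s G := by
  classical
  intro a b hab v w hvw
  obtain ⟨z, hz, hz'⟩ := h (Finset.univ.image v ∪ Finset.univ.image w)
    (by
      refine (Finset.card_union_le _ _).trans ?_
      have h₁ := Finset.card_image_le (s := Finset.univ) (f := v)
      have h₂ := Finset.card_image_le (s := Finset.univ) (f := w)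
      simp only [Finset.card_univ, Fintype.card_fin] at h₁ h₂
      omega)
    (fun x => ∃ i, v i = x)
  refine ⟨z, fun i => (hz' _ (by simp)).2 ⟨i, rfl⟩, fun j => ⟨fun hj => ?_, ?_⟩⟩
  · obtain ⟨i, hi⟩ := (hz' (w j) (by simp)).1 hj
    exact hvw i j hi
  · rintro rfl
    exact hz (by simp)

theorem ExtensionProperty.compl [Nonempty V] (hG : ExtensionProperty s G) :
    ExtensionProperty s Gᶜ := by
  refine extensionProperty_of_exists_pattern fun S hS p => ?_
  obtain ⟨z, hz, hz'⟩ := hG.exists_pattern S hS (fun v => ¬ p v)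
  refine ⟨z, hz, fun v hv => ?_⟩
  have : z ≠ v := fun h => hz (h ▸ hv)
  rw [SimpleGraph.compl_adj, hz' v hv]
  tauto

theorem ExtensionProperty.exists_adj_pair [Nonempty V] (hG : ExtensionProperty s G) (hs : 2 ≤ s)
    (u v : V) (p q : Prop) (huv : u ≠ v) :
    ∃ z, z ≠ u ∧ z ≠ v ∧ (G.Adj z u ↔ p) ∧ (G.Adj z v ↔ q) := by
  classical
  obtain ⟨z, hz, hz'⟩ := hG.exists_pattern {u, v} (Finset.card_le_two.trans hs)
    (fun x => (x = u ∧ p) ∨ (x = v ∧ q))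
  simp only [Finset.mem_insert, Finset.mem_singleton, not_or, forall_eq_or_imp, forall_eq] at hz hz'
  refine ⟨z, hz.1, hz.2, ?_, ?_⟩
  · simpa [huv] using hz'.1
  · simpa [huv.symm] using hz'.2

theorem ExtensionProperty.exists_adj_triple [Nonempty V] (hG : ExtensionProperty s G) (hs : 3 ≤ s)
    (u v w : V) (p q r : Prop) (huv : u ≠ v) (huw : u ≠ w) (hvw : v ≠ w) :
    ∃ z, z ≠ u ∧ z ≠ v ∧ z ≠ w ∧ (G.Adj z u ↔ p) ∧ (G.Adj z v ↔ q) ∧ (G.Adj z w ↔ r) := by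
  classical
  obtain ⟨z, hz, hz'⟩ := hG.exists_pattern {u, v, w} (Finset.card_le_three.trans hs)
    (fun x => (x = u ∧ p) ∨ (x = v ∧ q) ∨ (x = w ∧ r))
  simp only [Finset.mem_insert, Finset.mem_singleton, not_or, forall_eq_or_imp, forall_eq] at hz hz'
  refine ⟨z, hz.1, hz.2.1, hz.2.2, ?_, ?_, ?_⟩
  · simpa [huv, huw] using hz'.1
  · simpa [huv.symm, hvw] using hz'.2.1
  · simpa [huw.symm, hvw.symm] using hz'.2.2

/-- Vertices are chosen one at a time; the bound is `s + 1` because the last vertex is constrained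
only by the preceding ones. -/
theorem ExtensionProperty.exists_embedding [Nonempty V] (hG : ExtensionProperty s G)
    (A : ℕ → ℕ → Prop) {k : ℕ} (hk : k ≤ s + 1) :
    ∃ e : ℕ → V, ∀ j < k, ∀ i < j, e i ≠ e j ∧ (G.Adj (e j) (e i) ↔ A j i) := by
  classical
  induction k with
  | zero => exact ⟨fun _ => Classical.arbitrary V, by simp⟩
  | succ k ih =>
    obtain ⟨e, he⟩ := ih (by omega)
    have hinj : ∀ i < k, ∀ j < k, e i = e j → i = j := by
      intro i hi j hj hij
      rcases lt_trichotomy i j with h | h | h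
      · exact absurd hij (he j hj i h).1
      · exact h
      · exact absurd hij.symm (he i hi j h).1
    obtain ⟨z, hz, hz'⟩ := hG.exists_pattern ((Finset.range k).image e)
      (Finset.card_image_le.trans (by simpa using hk)) (fun x => ∃ i < k, e i = x ∧ A k i)
    refine ⟨Function.update e k z, fun j hj i hij => ?_⟩
    rw [Function.update_of_ne (by omega : i ≠ k)]
    rcases Nat.lt_succ_iff_lt_or_eq.1 hj with h | rfl
    · rw [Function.update_of_ne h.ne]
      exact he j h i hij
    · rw [Function.update_self]
      have hmem : e i ∈ (Finset.range j).image e := Finset.mem_image_of_mem _ (by simpa using hij)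
      refine ⟨fun h => hz (h ▸ hmem), (hz' _ hmem).trans ⟨?_, fun h => ⟨i, hij, rfl, h⟩⟩⟩
      rintro ⟨i', hi', h, hA⟩
      rwa [← hinj i' hi' i hij h]

end Extension

/-! ### Sets defined by few parameters -/

/-- A description of a set of vertices by `k` parameters: the adjacency between the parameters,
which of them belong to the set, and a rule that decides from its adjacency to the parameters
whether any other vertex belongs to the set. -/
structure Shape (k : ℕ) where
  adj : Fin k → Fin k → Bool
  mem : Fin k → Bool
  rule : (Fin k → Bool) → Bool

namespace Shape

variable {k : ℕ} (D : Shape k) {V : Type u} {G : SimpleGraph V}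

open Classical in
/-- The set described by `D` with parameters `e`. -/
def toSet (G : SimpleGraph V) (e : Fin k → V) : Set V :=
  {x | (∃ i, e i = x ∧ D.mem i = true) ∨
    ((∀ i, e i ≠ x) ∧ D.rule (fun i => decide (G.Adj x (e i))) = true)}

/-- The parameters `e` are distinct and have the adjacency prescribed by `D`. -/
def IsRealization (G : SimpleGraph V) (e : Fin k → V) : Prop :=
  Function.Injective e ∧ ∀ i j, i ≠ j → (G.Adj (e i) (e j) ↔ D.adj i j = true)

/-- The profiles of the vertices in a graph with the extension property, for the set described
by `D`. -/
def profileFinset : Finset Profile :=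
  (Finset.univ.image fun i : Fin k => (D.mem i, fun m a =>
    decide ((∃ c, D.rule c = m ∧ c i = a) ∨ ∃ j, j ≠ i ∧ D.mem j = m ∧ D.adj i j = a))) ∪
  Finset.univ.image fun c : Fin k → Bool => (D.rule c, fun m a =>
    decide ((∃ c', D.rule c' = m) ∨ ∃ j, D.mem j = m ∧ c j = a))

theorem exists_isRealization [Nonempty V] {s : ℕ} (hG : ExtensionProperty s G) (hk : k ≤ s + 1)
    (hD : ∀ i j, D.adj i j = D.adj j i) : ∃ e : Fin k → V, D.IsRealization G e := by
  obtain ⟨e, he⟩ := hG.exists_embedding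
    (fun j i => ∃ (hj : j < k) (hi : i < k), D.adj ⟨j, hj⟩ ⟨i, hi⟩ = true) hk
  have key : ∀ i j : Fin k, i < j → (G.Adj (e j) (e i) ↔ D.adj j i = true) := fun i j hij => by
    simpa using (he j j.2 i hij).2
  refine ⟨fun i => e i, fun i j hij => ?_, fun i j hij => ?_⟩
  · by_contra hne
    rcases lt_or_gt_of_ne hne with h | h
    · exact (he j j.2 i h).1 hij
    · exact (he i i.2 j h).1 hij.symm
  · rcases lt_or_gt_of_ne hij with h | h
    · rw [G.adj_comm, key i j h, hD]
    · exact key j i h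

variable {D}

theorem mem_toSet_apply {e : Fin k → V} (he : D.IsRealization G e) (i : Fin k) :
    e i ∈ D.toSet G e ↔ D.mem i = true := by
  constructor
  · rintro (⟨j, hj, hm⟩ | ⟨h, -⟩)
    · rwa [← he.1 hj]
    · exact absurd rfl (h i)
  · exact fun h => Or.inl ⟨i, rfl, h⟩

open Classical in
theorem mem_toSet_of_ne {e : Fin k → V} {x : V} (hx : ∀ i, e i ≠ x) :
    x ∈ D.toSet G e ↔ D.rule (fun i => decide (G.Adj x (e i))) = true := by
  constructor
  · rintro (⟨j, hj, -⟩ | ⟨-, h⟩)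
    · exact absurd hj (hx j)
    · exact h
  · exact fun h => Or.inr ⟨hx, h⟩

-- A cell is the set of vertices with a given adjacency to the parameters. From any vertex that is
-- not a parameter, each cell is seen with both adjacencies; this uses a pattern on `k + 1`
-- vertices.
open Classical in
theorem exists_cell [Nonempty V] {s : ℕ} (hG : ExtensionProperty s G) (hk : k + 1 ≤ s)
    {e : Fin k → V} (he : Function.Injective e) (c : Fin k → Bool) (x : V) (hx : ∀ i, e i ≠ x)
    (a : Bool) :
    ∃ z, z ≠ x ∧ (∀ i, e i ≠ z) ∧ (∀ i, decide (G.Adj z (e i)) = c i) ∧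
      (G.Adj x z ↔ a = true) := by
  obtain ⟨z, hz, hz'⟩ := hG.exists_pattern (insert x (Finset.univ.image e))
    ((Finset.card_insert_le _ _).trans (by
      have := Finset.card_image_le (s := Finset.univ) (f := e)
      simp only [Finset.card_univ, Fintype.card_fin] at this
      omega))
    (fun v => (v = x ∧ a = true) ∨ ∃ i, e i = v ∧ c i = true)
  simp only [Finset.mem_insert, Finset.mem_image, Finset.mem_univ, true_and, not_or,
    not_exists] at hz
  refine ⟨z, hz.1, hz.2, fun i => ?_, ?_⟩
  · have := hz' (e i) (by simp)
    simp only [hx i, false_and, false_or, he.eq_iff, exists_eq_left] at this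
    rw [Bool.eq_iff_iff, decide_eq_true_eq, this]
  · rw [G.adj_comm, hz' x (by simp)]
    simp [hx]

open Classical in
theorem profile_apply [Nonempty V] {s : ℕ} (hG : ExtensionProperty s G) (hk : k + 1 ≤ s)
    {e : Fin k → V} (he : D.IsRealization G e) (i : Fin k) :
    profile G (D.toSet G e) (e i) = (D.mem i, fun m a =>
      decide ((∃ c, D.rule c = m ∧ c i = a) ∨ ∃ j, j ≠ i ∧ D.mem j = m ∧ D.adj i j = a)) := by
  rw [profile_eq_iff]
  refine ⟨mem_toSet_apply he i, fun m a => ?_⟩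
  simp only [decide_eq_true_eq]
  constructor
  · rintro ⟨z, hz, hm, ha⟩
    by_cases h : ∃ j, e j = z
    · obtain ⟨j, rfl⟩ := h
      have hji : j ≠ i := fun h => hz (h ▸ rfl)
      rw [mem_toSet_apply he] at hm
      rw [he.2 i j hji.symm] at ha
      exact Or.inr ⟨j, hji, Bool.eq_iff_iff.2 hm, Bool.eq_iff_iff.2 ha⟩
    · push Not at h
      rw [mem_toSet_of_ne h] at hm
      refine Or.inl ⟨_, Bool.eq_iff_iff.2 hm, ?_⟩
      rw [Bool.eq_iff_iff, ← ha, decide_eq_true_eq, G.adj_comm]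
  · rintro (⟨c, hm, ha⟩ | ⟨j, hji, hm, ha⟩)
    · obtain ⟨x, hx, -⟩ := hG.exists_pattern (Finset.univ.image e)
        (Finset.card_image_le.trans (by simp; omega)) (fun _ => True)
      obtain ⟨z, -, hz, hc, -⟩ := exists_cell hG hk he.1 c x (by simpa using hx) true
      refine ⟨z, (hz i).symm, ?_, ?_⟩
      · rw [mem_toSet_of_ne hz, ← hm, ← funext hc]
      · rw [G.adj_comm, ← ha, ← hc i, decide_eq_true_eq]
    · exact ⟨e j, he.1.ne hji, by rw [mem_toSet_apply he, hm], by rw [he.2 i j hji.symm, ha]⟩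

open Classical in
theorem profile_of_ne [Nonempty V] {s : ℕ} (hG : ExtensionProperty s G) (hk : k + 1 ≤ s)
    {e : Fin k → V} (he : D.IsRealization G e) {x : V} (hx : ∀ i, e i ≠ x) :
    profile G (D.toSet G e) x = (D.rule (fun i => decide (G.Adj x (e i))), fun m a =>
      decide ((∃ c', D.rule c' = m) ∨
        ∃ j, D.mem j = m ∧ (decide (G.Adj x (e j)) : Bool) = a)) := by
  rw [profile_eq_iff]
  refine ⟨mem_toSet_of_ne hx, fun m a => ?_⟩
  simp only [decide_eq_true_eq]
  constructor
  · rintro ⟨z, hz, hm, ha⟩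
    by_cases h : ∃ j, e j = z
    · obtain ⟨j, rfl⟩ := h
      rw [mem_toSet_apply he] at hm
      exact Or.inr ⟨j, Bool.eq_iff_iff.2 hm, by rw [Bool.eq_iff_iff, ← ha, decide_eq_true_eq]⟩
    · push Not at h
      rw [mem_toSet_of_ne h] at hm
      exact Or.inl ⟨_, Bool.eq_iff_iff.2 hm⟩
  · rintro (⟨c, hm⟩ | ⟨j, hm, ha⟩)
    · obtain ⟨z, hzx, hz, hc, ha⟩ := exists_cell hG hk he.1 c x hx a
      exact ⟨z, hzx, by rw [mem_toSet_of_ne hz, ← hm, ← funext hc], ha⟩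
    · exact ⟨e j, hx j, by rw [mem_toSet_apply he, hm], by rw [← ha, decide_eq_true_eq]⟩

/-- Every cell is inhabited and what a vertex sees is determined by `D` and its cell, so the
profiles do not depend on the graph. This reduces the realization of a profile set in `H` to a
finite computation. -/
theorem profiles_toSet [Nonempty V] {s : ℕ} (hG : ExtensionProperty s G) (hk : k + 1 ≤ s)
    {e : Fin k → V} (he : D.IsRealization G e) :
    profiles G (D.toSet G e) = D.profileFinset := by
  classical
  ext t
  simp only [profileFinset, Finset.coe_union, Finset.coe_image, Finset.coe_univ, Set.image_univ,
    Set.mem_union, Set.mem_range, profiles]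
  constructor
  · rintro ⟨x, rfl⟩
    by_cases h : ∃ j, e j = x
    · obtain ⟨i, rfl⟩ := h
      exact Or.inl ⟨i, by rw [profile_apply hG hk he]⟩
    · push Not at h
      exact Or.inr ⟨_, by rw [profile_of_ne hG hk he h]⟩
  · rintro (⟨i, rfl⟩ | ⟨c, rfl⟩)
    · exact ⟨e i, by rw [profile_apply hG hk he]⟩
    · obtain ⟨y, hy, -⟩ := hG.exists_pattern (Finset.univ.image e)
        (Finset.card_image_le.trans (by simp; omega)) (fun _ => True)
      obtain ⟨z, -, hz, hc, -⟩ := exists_cell hG hk he.1 c y (by simpa using hy) true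
      refine ⟨z, ?_⟩
      rw [profile_of_ne hG hk he hz, funext hc]
      simp [hc]

theorem exists_profiles_eq (D : Shape k) [Nonempty V] {s : ℕ} (hG : ExtensionProperty s G)
    (hk : k + 1 ≤ s) (hD : ∀ i j, D.adj i j = D.adj j i) :
    ∃ X, profiles G X = D.profileFinset := by
  obtain ⟨e, he⟩ := D.exists_isRealization hG (by omega) hD
  exact ⟨_, profiles_toSet hG hk he⟩

end Shape

/-! ### Complements of sets and of graphs -/

section Duality

variable {V : Type u} {W : Type v}

/-- The effect on profiles of replacing the set by its complement. -/
def Profile.flipMem (t : Profile) : Profile := (!t.1, fun m a => t.2 (!m) a)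

/-- The effect on profiles of replacing the graph by its complement. -/
def Profile.flipAdj (t : Profile) : Profile := (t.1, fun m a => t.2 m (!a))

theorem sees_compl_set {G : SimpleGraph V} {X : Set V} {x : V} {m a : Bool} :
    Sees G Xᶜ x m a ↔ Sees G X x (!m) a := by
  refine exists_congr fun z => ?_
  cases m <;> simp

theorem sees_compl_graph {G : SimpleGraph V} {X : Set V} {x : V} {m a : Bool} :
    Sees Gᶜ X x m a ↔ Sees G X x m (!a) := by
  refine exists_congr fun z => and_congr_right fun hz => ?_
  cases a <;> simp [SimpleGraph.compl_adj, hz.symm]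

theorem profiles_compl_set (G : SimpleGraph V) (X : Set V) :
    profiles G Xᶜ = Profile.flipMem '' profiles G X := by
  rw [profiles, profiles, ← Set.range_comp]
  congr 1
  funext x
  rw [profile_eq_iff]
  simp [profile, Profile.flipMem, sees_compl_set]

theorem profiles_compl_graph (G : SimpleGraph V) (X : Set V) :
    profiles Gᶜ X = Profile.flipAdj '' profiles G X := by
  rw [profiles, profiles, ← Set.range_comp]
  congr 1
  funext x
  rw [profile_eq_iff]
  simp [profile, Profile.flipAdj, sees_compl_graph]

theorem exists_profiles_eq_of_compl_set {G : SimpleGraph V} {H : SimpleGraph W} {X : Set V}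
    (h : ∃ Y, profiles G Xᶜ = profiles H Y) : ∃ Y, profiles G X = profiles H Y := by
  obtain ⟨Y, hY⟩ := h
  refine ⟨Yᶜ, ?_⟩
  rw [profiles_compl_set, ← hY, ← profiles_compl_set, compl_compl]

theorem exists_profiles_eq_of_compl_graph {G : SimpleGraph V} {H : SimpleGraph W} {X : Set V}
    (h : ∃ Y, profiles Gᶜ X = profiles Hᶜ Y) : ∃ Y, profiles G X = profiles H Y := by
  obtain ⟨Y, hY⟩ := h
  refine ⟨Y, ?_⟩
  rw [← compl_compl G, ← compl_compl H, profiles_compl_graph Gᶜ, hY, ← profiles_compl_graph]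

theorem extAdj_iff_extNonAdj_compl {G : SimpleGraph V} {X : Set V} :
    ExtAdj G X ↔ ExtNonAdj Gᶜ X := by
  refine exists_congr fun x => and_congr_right fun hx => forall₂_congr fun y hy => ?_
  have : x ≠ y := fun h => hx (h ▸ hy)
  simp [SimpleGraph.compl_adj, this]

theorem extNonAdj_iff_extAdj_compl {G : SimpleGraph V} {X : Set V} :
    ExtNonAdj G X ↔ ExtAdj Gᶜ X := by
  rw [extAdj_iff_extNonAdj_compl, compl_compl]

theorem isIndepSet_iff_isClique_compl {G : SimpleGraph V} {X : Set V} :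
    G.IsIndepSet X ↔ Gᶜ.IsClique X :=
  (SimpleGraph.isClique_compl ..).symm

theorem maxIndep_iff_maxClique_compl {G : SimpleGraph V} {X : Set V} :
    MaxIndep G X ↔ MaxClique Gᶜ X :=
  and_congr isIndepSet_iff_isClique_compl (not_congr extNonAdj_iff_extAdj_compl)

theorem phiI1_iff {G : SimpleGraph V} : PhiI1 G ↔ PhiC1 Gᶜ := by
  simp only [PhiI1, PhiC1, isIndepSet_iff_isClique_compl, extAdj_iff_extNonAdj_compl]

theorem phiI2_iff {G : SimpleGraph V} : PhiI2 G ↔ PhiC2 Gᶜ := by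
  simp only [PhiI2, PhiC2, maxIndep_iff_maxClique_compl, extAdj_iff_extNonAdj_compl]

theorem phiI3_iff {G : SimpleGraph V} : PhiI3 G ↔ PhiC3 Gᶜ := by
  simp only [PhiI3, PhiC3, isIndepSet_iff_isClique_compl, maxIndep_iff_maxClique_compl,
    extAdj_iff_extNonAdj_compl]

end Duality

/-! ### Sets with vertices seeing everything -/

/-- The second component of the profile of a vertex that sees everything. -/
def full : Bool → Bool → Bool := fun _ _ => true

/-- The second component of the profile of a vertex `x` that sees everything but the members of
`X` whose adjacency to `x` is given by `a`. -/
def missing (a : Bool) : Bool → Bool → Bool := fun m a' => !(m && (a' == a))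

/-- The intersection of neighbourhoods and sets of non-neighbours of the parameters, together with
some of the parameters. -/
def meetShape {k : ℕ} (mem sgn : Fin k → Bool) : Shape k where
  -- A parameter in the set satisfies the conditions imposed by the other parameters. Symmetry
  -- requires equal signs for any two distinct parameters in the set.
  adj i j := if mem j then sgn i else if mem i then sgn j else false
  mem := mem
  rule c := decide (c = sgn)

/-- The symmetric difference of two neighbourhoods. -/
def symmDiffShape : Shape 2 where
  adj _ _ := false
  mem _ := false
  rule c := xor (c 0) (c 1)

/-- A pair of adjacent vertices. -/
def edgeShape : Shape 2 where
  adj _ _ := true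
  mem _ := true
  rule _ := false

/-- A part of a single vertex. -/
def pointShape (m : Bool) : Shape 1 where
  adj _ _ := false
  mem _ := m
  rule _ := false

/-- The vertices whose adjacency to a given one is `a`, with or without that one. -/
def neighborShape (m a : Bool) : Shape 1 where
  adj _ _ := false
  mem _ := m
  rule c := c 0 == a

section Realize

variable {V : Type u} {W : Type v} [Nonempty V] [Nonempty W] {G : SimpleGraph V}
  {H : SimpleGraph W} {s : ℕ} {X : Set V}

theorem Shape.exists_profiles_eq_of_eq_toSet (hG : ExtensionProperty s G)
    (hH : ExtensionProperty s H) {k : ℕ} (D : Shape k) (hk : k + 1 ≤ s)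
    (hD : ∀ i j, D.adj i j = D.adj j i) {e : Fin k → V} (he : D.IsRealization G e)
    (hX : X = D.toSet G e) : ∃ Y, profiles G X = profiles H Y := by
  obtain ⟨Y, hY⟩ := D.exists_profiles_eq hH hk hD
  exact ⟨Y, by rw [hX, Shape.profiles_toSet hG hk he, hY]⟩

theorem exists_profiles_eq_of_subset_singleton (hG : ExtensionProperty s G)
    (hH : ExtensionProperty s H) (hs : 2 ≤ s) (p : V) (hX : X ⊆ {p}) :
    ∃ Y, profiles G X = profiles H Y := by
  classical
  refine Shape.exists_profiles_eq_of_eq_toSet hG hH (pointShape (decide (p ∈ X))) hs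
    (fun _ _ => rfl) (e := fun _ => p)
    ⟨fun i j _ => Subsingleton.elim i j, fun i j h => absurd (Subsingleton.elim i j) h⟩ ?_
  ext z
  simp only [Shape.toSet, pointShape, Set.mem_ofPred_eq, decide_eq_true_eq, Bool.false_eq_true,
    and_false, or_false, exists_const]
  exact ⟨fun h => ⟨(hX h).symm, hX h ▸ h⟩, fun h => h.1 ▸ h.2⟩

theorem exists_profiles_eq_of_forall_mem_iff_adj (hG : ExtensionProperty s G)
    (hH : ExtensionProperty s H) (hs : 2 ≤ s) (p : V) (a : Bool)
    (hX : ∀ z, z ≠ p → (z ∈ X ↔ (G.Adj p z ↔ a = true))) :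
    ∃ Y, profiles G X = profiles H Y := by
  classical
  refine Shape.exists_profiles_eq_of_eq_toSet hG hH (neighborShape (decide (p ∈ X)) a) hs
    (fun _ _ => rfl) (e := fun _ => p)
    ⟨fun i j _ => Subsingleton.elim i j, fun i j h => absurd (Subsingleton.elim i j) h⟩ ?_
  ext z
  simp only [Shape.toSet, neighborShape, Set.mem_ofPred_eq, decide_eq_true_eq, exists_const,
    forall_const, beq_iff_eq]
  by_cases hz : z = p
  · subst hz
    simp
  · rw [hX z hz, G.adj_comm]
    cases a <;> simp [Ne.symm hz]

theorem exists_profiles_eq_of_full (hH : ExtensionProperty s H) (hs : 4 ≤ s) (p q r w : Bool)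
    (hpq : p = true → q = true → False) :
    ∃ Y, profiles H Y = ((({(true, full), (false, full)} ∪
      ((if p then {(true, missing true)} else ∅) ∪ if q then {(true, missing false)} else ∅)) ∪
      ((if r then {(false, missing true)} else ∅) ∪ if w then {(false, missing false)} else ∅) :
      Finset Profile) : Set Profile) := by
  have key : ∀ {k : ℕ} (D : Shape k) (T : Finset Profile), k ≤ 3 →
      (∀ i j, D.adj i j = D.adj j i) → D.profileFinset = T →
      ∃ Y, profiles H Y = (T : Set Profile) := by
    rintro k D T hk hD rfl
    exact D.exists_profiles_eq hH (by omega) hD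
  -- In these examples of `meetShape`, a parameter of sign `b` sees in the set only vertices of
  -- adjacency `b`, which gives the profile `missing (!b)`, inside or outside the set according to
  -- `mem`; vertices that are not parameters give the full profiles. At least two parameters are
  -- used, so that none of them misses a kind of non-member. With nothing to be missed, the
  -- symmetric difference serves.
  cases p <;> cases q <;> cases r <;> cases w
  · exact key symmDiffShape _ (by decide) (by decide) (by decide)
  · exact key (meetShape ![false, false] ![true, true]) _ (by decide) (by decide) (by decide)
  · exact key (meetShape ![false, false] ![false, false]) _ (by decide) (by decide) (by decide)
  · exact key (meetShape ![false, false] ![false, true]) _ (by decide) (by decide) (by decide)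
  · exact key (meetShape ![true, true] ![true, true]) _ (by decide) (by decide) (by decide)
  · exact key (meetShape ![true, false] ![true, true]) _ (by decide) (by decide) (by decide)
  · exact key (meetShape ![true, false] ![true, false]) _ (by decide) (by decide) (by decide)
  · exact key (meetShape ![true, false, false] ![true, false, true]) _
      (by decide) (by decide) (by decide)
  · exact key (meetShape ![true, true] ![false, false]) _ (by decide) (by decide) (by decide)
  · exact key (meetShape ![true, false] ![false, true]) _ (by decide) (by decide) (by decide)
  · exact key (meetShape ![true, false] ![false, false]) _ (by decide) (by decide) (by decide)
  · exact key (meetShape ![true, false, false] ![false, false, true]) _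
      (by decide) (by decide) (by decide)
  all_goals exact (hpq rfl rfl).elim

end Realize

/-! ### Cliques -/

section Cliques

variable {V : Type u} {W : Type v} {G : SimpleGraph V}
  {H : SimpleGraph W} {s : ℕ} {X : Set V}

open Classical in
theorem profile_eq_full {x : V} (h : ∀ m a, Sees G X x m a) :
    profile G X x = (decide (x ∈ X), full) := by
  rw [profile_eq_iff]
  exact ⟨by simp, fun m a => by simp [full, h]⟩

open Classical in
theorem profile_eq_missing {x : V} {a : Bool} (h : ∀ a', Sees G X x false a')
    (h₁ : Sees G X x true (!a)) (h₂ : ¬ Sees G X x true a) :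
    profile G X x = (decide (x ∈ X), missing a) := by
  rw [profile_eq_iff]
  refine ⟨by simp, fun m a' => ?_⟩
  cases m
  · simp [missing, h]
  · by_cases ha : a' = a
    · subst ha
      simp [missing, h₂]
    · have : a' = !a := by cases a <;> cases a' <;> simp_all
      subst this
      simp [missing, h₁]

theorem sees_true_true_iff {x : V} :
    Sees G X x true true ↔ ∃ y ∈ X, G.Adj x y := by
  constructor
  · rintro ⟨z, -, hz, ha⟩
    exact ⟨z, hz.2 rfl, ha.2 rfl⟩
  · rintro ⟨y, hy, ha⟩
    exact ⟨y, ha.ne', by simpa, by simpa⟩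

theorem sees_true_false_iff {x : V} (hx : x ∉ X) :
    Sees G X x true false ↔ ∃ y ∈ X, ¬ G.Adj x y := by
  constructor
  · rintro ⟨z, -, hz, ha⟩
    exact ⟨z, hz.2 rfl, by simpa using ha⟩
  · rintro ⟨y, hy, ha⟩
    exact ⟨y, fun h => hx (h ▸ hy), by simpa, by simpa⟩

/-- If the first candidate `y` lies in the clique, a vertex `z` with the required adjacency to `x`
and not adjacent to `y` lies outside it. -/
theorem sees_false_of_isClique [Nonempty V] (hG : ExtensionProperty s G) (hs : 2 ≤ s)
    (hX : G.IsClique X) (x : V) (a : Bool) : Sees G X x false a := by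
  obtain ⟨y, hy, hya⟩ : ∃ z, z ≠ x ∧ (G.Adj z x ↔ a = true) := by
    obtain ⟨z, hz, hz'⟩ := hG.exists_pattern {x} (by simp; omega) (fun _ => a = true)
    exact ⟨z, by simpa using hz, hz' x (by simp)⟩
  obtain ⟨z, hzx, hzy, hza, hzn⟩ := hG.exists_adj_pair hs x y (a = true) False hy.symm
  by_cases h : y ∈ X
  · refine ⟨z, hzx, ?_, by rw [G.adj_comm, hza]⟩
    have : z ∉ X := fun hz => hzn.1 (hX hz h hzy)
    simpa
  · exact ⟨y, hy, by simpa, by rw [G.adj_comm, hya]⟩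

-- Members see only adjacent members. An outer vertex misses a kind of member exactly when it
-- witnesses `ExtNonAdj` or `ExtAdj`, and a vertex separating two members has the full profile.
open Classical in
theorem profiles_of_isClique [Nonempty V] (hG : ExtensionProperty s G) (hs : 2 ≤ s)
    (hX : G.IsClique X) (hX' : X.Nontrivial) (t : Profile) :
    t ∈ profiles G X ↔ t = (true, missing false) ∨ t = (false, full) ∨
      (ExtNonAdj G X ∧ t = (false, missing true)) ∨ (ExtAdj G X ∧ t = (false, missing false)) := by
  have hfalse := sees_false_of_isClique hG hs hX
  have hin : ∀ x ∈ X, profile G X x = (true, missing false) := by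
    intro x hx
    obtain ⟨y, hy, hyx⟩ := hX'.exists_ne x
    have := profile_eq_missing (a := false) (hfalse x)
      ⟨y, hyx, by simpa, by simpa using hX hx hy hyx.symm⟩ (by
        rintro ⟨z, hz, hm, ha⟩
        simp only [iff_true, Bool.false_eq_true, iff_false] at hm ha
        exact ha (hX hx hm hz.symm))
    simpa [hx] using this
  have hA : ∀ x, x ∉ X → (∀ y ∈ X, ¬ G.Adj x y) → profile G X x = (false, missing true) := by
    intro x hx h
    obtain ⟨y, hy⟩ := hX'.nonempty
    have := profile_eq_missing (a := true) (hfalse x)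
      ((sees_true_false_iff hx).2 ⟨y, hy, h y hy⟩) (by
        rw [sees_true_true_iff]
        push Not
        exact h)
    simpa [hx] using this
  have hN : ∀ x, x ∉ X → (∀ y ∈ X, G.Adj x y) → profile G X x = (false, missing false) := by
    intro x hx h
    obtain ⟨y, hy⟩ := hX'.nonempty
    have := profile_eq_missing (a := false) (hfalse x)
      ((sees_true_true_iff).2 ⟨y, hy, h y hy⟩) (by
        rw [sees_true_false_iff hx]
        push Not
        exact h)
    simpa [hx] using this
  have hF : ∀ x, x ∉ X → (∃ y ∈ X, G.Adj x y) → (∃ y ∈ X, ¬ G.Adj x y) →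
      profile G X x = (false, full) := by
    intro x hx h h'
    have := profile_eq_full (G := G) (X := X) (x := x) (by
      rintro (_ | _) a
      · exact hfalse x a
      · cases a
        · exact (sees_true_false_iff hx).2 h'
        · exact (sees_true_true_iff).2 h)
    simpa [hx] using this
  constructor
  · rintro ⟨x, rfl⟩
    by_cases hx : x ∈ X
    · exact Or.inl (hin x hx)
    by_cases h : ∃ y ∈ X, G.Adj x y
    · by_cases h' : ∃ y ∈ X, ¬ G.Adj x y
      · exact Or.inr (Or.inl (hF x hx h h'))
      · push Not at h'
        exact Or.inr (Or.inr (Or.inr ⟨⟨x, hx, h'⟩, hN x hx h'⟩))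
    · push Not at h
      exact Or.inr (Or.inr (Or.inl ⟨⟨x, hx, h⟩, hA x hx h⟩))
  · rintro (rfl | rfl | ⟨⟨x, hx, h⟩, rfl⟩ | ⟨⟨x, hx, h⟩, rfl⟩)
    · obtain ⟨x, hx⟩ := hX'.nonempty
      exact ⟨x, hin x hx⟩
    · obtain ⟨x, hx, y, hy, hxy⟩ := hX'
      obtain ⟨z, -, hzy, hx', hy'⟩ := hG.exists_adj_pair hs x y True False hxy
      exact ⟨z, hF z (fun hz => hy'.1 (hX hz hy hzy)) ⟨x, hx, hx'.2 trivial⟩ ⟨y, hy, hy'.1⟩⟩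
    · exact ⟨x, hA x hx h⟩
    · exact ⟨x, hN x hx h⟩

theorem profiles_eq_of_isClique [Nonempty V] [Nonempty W] {Y : Set W} (hG : ExtensionProperty s G)
    (hH : ExtensionProperty s H) (hs : 2 ≤ s) (hX : G.IsClique X) (hX' : X.Nontrivial)
    (hY : H.IsClique Y) (hY' : Y.Nontrivial) (h₁ : ExtNonAdj G X ↔ ExtNonAdj H Y)
    (h₂ : ExtAdj G X ↔ ExtAdj H Y) : profiles G X = profiles H Y := by
  ext t
  rw [profiles_of_isClique hG hs hX hX', profiles_of_isClique hH hs hY hY', h₁, h₂]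

theorem nontrivial_of_not_extNonAdj [Nonempty V] (hG : ExtensionProperty s G) (hs : 2 ≤ s)
    (h : ¬ ExtNonAdj G X) : X.Nontrivial := by
  by_contra hX
  rw [Set.not_nontrivial_iff] at hX
  rcases hX.eq_empty_or_singleton with rfl | ⟨x, rfl⟩
  · exact h ⟨Classical.arbitrary V, by simp⟩
  · obtain ⟨z, hz, hz'⟩ := hG.exists_pattern {x} (by simp; omega) (fun _ => False)
    exact h ⟨z, by simpa using hz, by simpa using hz'⟩

theorem nontrivial_of_not_extAdj [Nonempty V] (hG : ExtensionProperty s G) (hs : 2 ≤ s)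
    (h : ¬ ExtAdj G X) : X.Nontrivial :=
  nontrivial_of_not_extNonAdj hG.compl hs (fun h' => h (extAdj_iff_extNonAdj_compl.2 h'))

theorem ExtNonAdj.anti {Y : Set V} (h : ExtNonAdj G Y) (hXY : X ⊆ Y) : ExtNonAdj G X := by
  obtain ⟨x, hx, hx'⟩ := h
  exact ⟨x, fun h => hx (hXY h), fun y hy => hx' y (hXY hy)⟩

theorem exists_maxClique_superset (hX : G.IsClique X) : ∃ Y, X ⊆ Y ∧ MaxClique G Y := by
  obtain ⟨Y, hXY, hY⟩ := zorn_subset_nonempty {Y | G.IsClique Y} (fun c hc hchain _ => by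
    refine ⟨⋃₀ c, ?_, fun s hs => Set.subset_sUnion_of_mem hs⟩
    rintro x ⟨A, hA, hx⟩ y ⟨B, hB, hy⟩ hxy
    rcases hchain.total hA hB with h | h
    · exact hc hB (h hx) hy hxy
    · exact hc hA hx (h hy) hxy) X hX
  refine ⟨Y, hXY, hY.prop, ?_⟩
  rintro ⟨x, hx, hadj⟩
  have hins : G.IsClique (insert x Y) := by
    rw [SimpleGraph.isClique_insert]
    exact ⟨hY.prop, fun b hb _ => hadj b hb⟩
  exact hx (hY.le_of_ge hins (Set.subset_insert x Y) (Set.mem_insert x Y))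

/-- A counterexample to `PhiC2` has `ExtNonAdj` only, one to `PhiC3` has `ExtAdj` only, and one to
`PhiC1` extends to a clique with neither. If both hold, an edge of `H` will do. -/
theorem exists_profiles_eq_of_isClique [Nonempty V] [Nonempty W]
    (hG : ExtensionProperty s G) (hH : ExtensionProperty s H)
    (hs : 4 ≤ s) (h₁ : PhiC1 G ↔ PhiC1 H) (h₂ : PhiC2 G ↔ PhiC2 H) (h₃ : PhiC3 G ↔ PhiC3 H)
    (hX : G.IsClique X) (hX' : X.Nontrivial) : ∃ Y, profiles G X = profiles H Y := by
  have hs' : 2 ≤ s := by omega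
  by_cases hN : ExtNonAdj G X
  · by_cases hA : ExtAdj G X
    · obtain ⟨e, he⟩ := edgeShape.exists_isRealization hH (by omega) (by decide)
      have hadj : H.Adj (e 0) (e 1) := (he.2 0 1 (by decide)).2 rfl
      refine ⟨{e 0, e 1}, profiles_eq_of_isClique hG hH hs' hX hX' ?_ ?_ ?_ ?_⟩
      · rw [SimpleGraph.isClique_pair]
        exact fun _ => hadj
      · exact Set.nontrivial_pair hadj.ne
      · refine iff_of_true hN ?_
        obtain ⟨z, h0, h1, hz0, hz1⟩ := hH.exists_adj_pair hs' _ _ False False hadj.ne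
        exact ⟨z, by simp [h0, h1], by simp [hz0, hz1]⟩
      · refine iff_of_true hA ?_
        obtain ⟨z, h0, h1, hz0, hz1⟩ := hH.exists_adj_pair hs' _ _ True True hadj.ne
        exact ⟨z, by simp [h0, h1], by simp [hz0, hz1]⟩
    · have : ¬ PhiC2 H := fun h => h₂.2 h X ⟨hX, hA⟩ hN
      simp only [PhiC2, not_forall, not_not] at this
      obtain ⟨Y, hY, hY'⟩ := this
      exact ⟨Y, profiles_eq_of_isClique hG hH hs' hX hX' hY.1 (nontrivial_of_not_extAdj hH hs' hY.2)
        (iff_of_true hN hY') (iff_of_false hA hY.2)⟩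
  · by_cases hA : ExtAdj G X
    · have : ¬ PhiC3 H := fun h => (h₃.2 h X ⟨hX, hN⟩).2 hA
      simp only [PhiC3, not_forall] at this
      obtain ⟨Y, ⟨hY, hY'⟩, hm⟩ := this
      exact ⟨Y, profiles_eq_of_isClique hG hH hs' hX hX' hY (nontrivial_of_not_extNonAdj hH hs' hY')
        (iff_of_false hN hY') (iff_of_true hA (by_contra fun h => hm ⟨hY, h⟩))⟩
    · have : ¬ PhiC1 H := fun h => hN (h₁.2 h X hX)
      simp only [PhiC1, not_forall] at this
      obtain ⟨Z, hZ, hZ'⟩ := this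
      -- Enlarging the clique removes `ExtAdj` and cannot create `ExtNonAdj`.
      obtain ⟨Y, hZY, hY⟩ := exists_maxClique_superset hZ
      exact ⟨Y, profiles_eq_of_isClique hG hH hs' hX hX' hY.1 (nontrivial_of_not_extAdj hH hs' hY.2)
        (iff_of_false hN fun h => hZ' (h.anti hZY)) (iff_of_false hA hY.2)⟩

end Cliques

/-! ### Transfer of sets between graphs with the extension property -/

section Transfer

variable {V : Type u} {W : Type v} {G : SimpleGraph V} {H : SimpleGraph W} {s : ℕ} {X : Set V}

/-- One vertex `z` has both prescribed adjacencies; it serves `p` or `q` according to whether it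
lies in `X`. -/
theorem ExtensionProperty.sees_or_sees [Nonempty V] (hG : ExtensionProperty s G) (hs : 2 ≤ s)
    {p q : V} (hpq : p ≠ q) (a b : Bool) : Sees G X p true a ∨ Sees G X q false b := by
  obtain ⟨z, hzp, hzq, ha, hb⟩ := hG.exists_adj_pair hs p q (a = true) (b = true) hpq
  by_cases hz : z ∈ X
  · exact Or.inl ⟨z, hzp, by simpa, by rw [G.adj_comm, ha]⟩
  · exact Or.inr ⟨z, hzq, by simpa, by rw [G.adj_comm, hb]⟩

theorem ExtensionProperty.mem_iff_of_not_sees [Nonempty V] (hG : ExtensionProperty s G)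
    (hs : 2 ≤ s) {p : V} {a b : Bool} (ha : ¬ Sees G X p true a) (hb : ¬ Sees G X p false b)
    {z : V} (hz : z ≠ p) : z ∈ X ↔ (G.Adj p z ↔ b = true) := by
  classical
  have hX : ∀ w, w ≠ p → w ∈ X → ¬ (G.Adj p w ↔ a = true) := fun w hw hm h =>
    ha ⟨w, hw, by simpa, h⟩
  have hX' : ∀ w, w ≠ p → w ∉ X → ¬ (G.Adj p w ↔ b = true) := fun w hw hm h =>
    hb ⟨w, hw, by simpa, h⟩
  -- If `a = b`, a vertex of this adjacency to `p` could lie neither in `X` nor outside it.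
  have hab : a ≠ b := by
    rintro rfl
    obtain ⟨w, hw, hw'⟩ := hG.exists_pattern {p} (by simp; omega) (fun _ => a = true)
    have hwp : w ≠ p := by simpa using hw
    have hadj : G.Adj p w ↔ a = true := by rw [G.adj_comm, hw' p (by simp)]
    by_cases h : w ∈ X
    · exact hX w hwp h hadj
    · exact hX' w hwp h hadj
  constructor
  · intro h
    have := hX z hz h
    cases a <;> cases b <;> simp_all
  · intro h
    by_contra hzX
    exact hX' z hz hzX h

/-- The case in which every vertex sees every kind of vertex outside `X`, and some vertex
of `X`. -/
theorem exists_profiles_eq_of_sees [Nonempty V] [Nonempty W] (hG : ExtensionProperty s G)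
    (hH : ExtensionProperty s H) (hs : 4 ≤ s)
    (hC₁ : PhiC1 G ↔ PhiC1 H) (hC₂ : PhiC2 G ↔ PhiC2 H) (hC₃ : PhiC3 G ↔ PhiC3 H)
    (hI₁ : PhiI1 G ↔ PhiI1 H) (hI₂ : PhiI2 G ↔ PhiI2 H) (hI₃ : PhiI3 G ↔ PhiI3 H)
    (hfalse : ∀ x a, Sees G X x false a) (htrue : ∀ x, ∃ a, Sees G X x true a) :
    ∃ Y, profiles G X = profiles H Y := by
  classical
  have hprof : ∀ x, ((∀ a, Sees G X x true a) ∧ profile G X x = (decide (x ∈ X), full)) ∨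
      ∃ a, ¬ Sees G X x true a ∧ profile G X x = (decide (x ∈ X), missing a) := by
    intro x
    by_cases h : ∀ a, Sees G X x true a
    · refine Or.inl ⟨h, profile_eq_full ?_⟩
      rintro (_ | _) a
      exacts [hfalse x a, h a]
    · push Not at h
      obtain ⟨a, ha⟩ := h
      obtain ⟨b, hb⟩ := htrue x
      have hba : b = !a := by
        have : b ≠ a := fun h => ha (h ▸ hb)
        cases a <;> cases b <;> simp_all
      exact Or.inr ⟨a, ha, profile_eq_missing (hfalse x) (hba ▸ hb) ha⟩
  have hsecond : ∀ t ∈ profiles G X, t.2 = full ∨ t.2 = missing true ∨ t.2 = missing false := by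
    rintro _ ⟨x, rfl⟩
    rcases hprof x with ⟨-, h⟩ | ⟨a, -, h⟩
    · simp [h]
    · cases a <;> simp [h]
  have hnontrivial : X.Nontrivial := by
    obtain ⟨a, x, -, hx, -⟩ := htrue (Classical.arbitrary V)
    obtain ⟨b, y, hyx, hy, -⟩ := htrue x
    exact ⟨y, by simpa using hy, x, by simpa using hx, hyx⟩
  have hout : (false, full) ∈ profiles G X := by
    obtain ⟨y, -, hy, -⟩ := hfalse (Classical.arbitrary V) true
    have hyX : y ∉ X := by simpa using hy
    rcases hprof y with ⟨-, h⟩ | ⟨a, ha, -⟩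
    · exact ⟨y, by simp [h, hyX]⟩
    obtain ⟨x₁, hx₁, x₂, hx₂, hne⟩ := hnontrivial
    -- The adjacency to `y` keeps `z` out of `X`, and separating two members gives `z` the full
    -- profile.
    obtain ⟨z, hz₁, hz₂, hzy, h₁, h₂, h₃⟩ := hG.exists_adj_triple (by omega) x₁ x₂ y True False
      (a = true) hne (fun h => hyX (h ▸ hx₁)) (fun h => hyX (h ▸ hx₂))
    have hzX : z ∉ X := fun hz => ha ⟨z, hzy, by simpa, by rw [G.adj_comm, h₃]⟩
    refine ⟨z, ?_⟩
    rw [profile_eq_full]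
    · simp [hzX]
    · rintro (_ | _) (_ | _)
      · exact hfalse z _
      · exact hfalse z _
      · exact (sees_true_false_iff hzX).2 ⟨x₂, hx₂, h₂.1⟩
      · exact sees_true_true_iff.2 ⟨x₁, hx₁, h₁.2 trivial⟩
  by_cases hin : (true, full) ∈ profiles G X
  · obtain ⟨Y, hY⟩ := exists_profiles_eq_of_full hH hs
      (decide ((true, missing true) ∈ profiles G X)) (decide ((true, missing false) ∈ profiles G X))
      (decide ((false, missing true) ∈ profiles G X))
      (decide ((false, missing false) ∈ profiles G X)) (by
        simp only [decide_eq_true_eq]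
        rintro ⟨x, hx⟩ ⟨y, hy⟩
        have hx' := profile_eq_iff.1 hx
        have hy' := profile_eq_iff.1 hy
        have hxX : x ∈ X := by simpa using hx'.1
        have hyX : y ∈ X := by simpa using hy'.1
        have hxs : ¬ Sees G X x true true := by simpa [missing] using hx'.2 true true
        have hys : ¬ Sees G X y true false := by simpa [missing] using hy'.2 true false
        have hne : x ≠ y := by
          rintro rfl
          obtain ⟨_ | _, h⟩ := htrue x
          exacts [hys h, hxs h]
        -- Whether `x` and `y` are adjacent or not, one of them sees the other as the kind it
        -- misses.
        by_cases hadj : G.Adj x y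
        · exact hxs ⟨y, hne.symm, by simpa, by simpa⟩
        · exact hys ⟨x, hne, by simpa, by simpa [G.adj_comm] using hadj⟩)
    refine ⟨Y, ?_⟩
    rw [hY]
    ext ⟨b, g⟩
    constructor
    · intro h
      rcases hsecond _ h with hg | hg | hg <;> simp only at hg <;> subst hg <;> cases b <;>
        simp [h]
    · simp only [Finset.coe_union, Set.mem_union, Finset.mem_coe, Finset.mem_insert,
        Finset.mem_singleton, decide_eq_true_eq]
      rintro (((h | h) | h | h) | h | h)
      · rwa [h]
      · rwa [h]
      all_goals
        split_ifs at h with h'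
        · rwa [Finset.mem_singleton.1 h]
        · simp at h
  · have hmiss : ∀ x ∈ X, ∃ a, ¬ Sees G X x true a := by
      intro x hx
      rcases hprof x with ⟨-, h⟩ | ⟨a, ha, -⟩
      · exact absurd ⟨x, by simp [h, hx]⟩ hin
      · exact ⟨a, ha⟩
    obtain ⟨x, hx⟩ := hnontrivial.nonempty
    obtain ⟨a, ha⟩ := hmiss x hx
    -- Distinct members see each other with the same adjacency, so all of them miss the same kind.
    -- Hence `X` is a clique or an independent set.
    have hmiss' : ∀ y ∈ X, ¬ Sees G X y true a := by
      intro y hy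
      by_cases hxy : y = x
      · rwa [hxy]
      obtain ⟨b, hb⟩ := hmiss y hy
      have h₁ : ¬ (G.Adj x y ↔ a = true) := fun h => ha ⟨y, hxy, by simpa, h⟩
      have h₂ : ¬ (G.Adj y x ↔ b = true) := fun h => hb ⟨x, Ne.symm hxy, by simpa, h⟩
      rw [G.adj_comm] at h₂
      have hab : b = a := by cases a <;> cases b <;> simp_all
      rwa [← hab]
    cases a with
    | false =>
      refine exists_profiles_eq_of_isClique hG hH hs hC₁ hC₂ hC₃ (fun y hy z hz hyz => ?_)
        hnontrivial
      by_contra h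
      exact hmiss' y hy ⟨z, hyz.symm, by simpa, by simpa⟩
    | true =>
      refine exists_profiles_eq_of_compl_graph (exists_profiles_eq_of_isClique hG.compl hH.compl hs
        (by rwa [← phiI1_iff, ← phiI1_iff]) (by rwa [← phiI2_iff, ← phiI2_iff])
        (by rwa [← phiI3_iff, ← phiI3_iff]) (fun y hy z hz hyz => ?_) hnontrivial)
      rw [SimpleGraph.compl_adj]
      exact ⟨hyz, fun h => hmiss' y hy ⟨z, hyz.symm, by simpa, by simpa⟩⟩

theorem exists_profiles_eq [Nonempty V] [Nonempty W] (hG : ExtensionProperty s G)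
    (hH : ExtensionProperty s H) (hs : 4 ≤ s)
    (hC₁ : PhiC1 G ↔ PhiC1 H) (hC₂ : PhiC2 G ↔ PhiC2 H) (hC₃ : PhiC3 G ↔ PhiC3 H)
    (hI₁ : PhiI1 G ↔ PhiI1 H) (hI₂ : PhiI2 G ↔ PhiI2 H) (hI₃ : PhiI3 G ↔ PhiI3 H) (X : Set V) :
    ∃ Y, profiles G X = profiles H Y := by
  have hs' : 2 ≤ s := by omega
  have key : ∀ X : Set V, (∀ x a, Sees G X x false a) → ∃ Y, profiles G X = profiles H Y := by
    intro X hfalse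
    by_cases htrue : ∀ x, ∃ a, Sees G X x true a
    · exact exists_profiles_eq_of_sees hG hH hs hC₁ hC₂ hC₃ hI₁ hI₂ hI₃ hfalse htrue
    · push Not at htrue
      obtain ⟨p, hp⟩ := htrue
      refine exists_profiles_eq_of_subset_singleton hG hH hs' p fun z hz => ?_
      classical
      by_contra hzp
      exact hp (decide (G.Adj p z)) ⟨z, hzp, by simpa, by simp⟩
  by_cases hfalse : ∀ x a, Sees G X x false a
  · exact key X hfalse
  by_cases htrue : ∀ x a, Sees G X x true a
  · exact exists_profiles_eq_of_compl_set (key _ fun x a => sees_compl_set.2 (htrue x a))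
  push Not at hfalse htrue
  obtain ⟨p, a, hp⟩ := htrue
  obtain ⟨q, b, hq⟩ := hfalse
  have hpq : p = q := by
    by_contra h
    rcases hG.sees_or_sees (X := X) hs' h a b with h | h
    exacts [hp h, hq h]
  subst hpq
  exact exists_profiles_eq_of_forall_mem_iff_adj hG hH hs' p b
    fun z hz => hG.mem_iff_of_not_sees hs' hp hq hz

theorem holds_iff_of_phi_iff [Nonempty V] [Nonempty W] (hG : ExtensionProperty s G)
    (hH : ExtensionProperty s H) (hs : 4 ≤ s)
    (hC₁ : PhiC1 G ↔ PhiC1 H) (hC₂ : PhiC2 G ↔ PhiC2 H) (hC₃ : PhiC3 G ↔ PhiC3 H)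
    (hI₁ : PhiI1 G ↔ PhiI1 H) (hI₂ : PhiI2 G ↔ PhiI2 H) (hI₃ : PhiI3 G ↔ PhiI3 H)
    (Ψ : E12Sentence) : Ψ.Holds G ↔ Ψ.Holds H :=
  ⟨.of_forall_exists_profiles_eq (exists_profiles_eq hG hH hs hC₁ hC₂ hC₃ hI₁ hI₂ hI₃),
    .of_forall_exists_profiles_eq
      (exists_profiles_eq hH hG hs hC₁.symm hC₂.symm hC₃.symm hI₁.symm hI₂.symm hI₃.symm)⟩

end Transfer

/-! ### Graphs with prescribed and generic adjacencies between classes -/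

section Counting

variable {E α β : Type} [Fintype E] [DecidableEq E] [DecidableEq α] [DecidableEq β]

/-- For a random `f`, each `z` realizes the pattern with probability `2 ^ (-|S|)`, and these events
are independent because they concern disjoint sets of pairs. -/
theorem card_filter_forall_not_le (e : α → β → E) (S : Finset β) (p : β → Bool) (Z : Finset α)
    (he : ∀ z ∈ Z, ∀ v ∈ S, ∀ z' ∈ Z, ∀ v' ∈ S, e z v = e z' v' → z = z' ∧ v = v') :
    ((Finset.univ.filter fun f : E → Bool => ∀ z ∈ Z, ¬ ∀ v ∈ S, f (e z v) = p v).card : ℝ) ≤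
      (1 - (1 / 2) ^ S.card) ^ Z.card * 2 ^ Fintype.card E := by
  classical
  induction Z using Finset.induction_on with
  | empty => simp
  | insert z Z hz ih =>
    have ih' := ih fun z hz v hv z' hz' v' hv' => he z (Finset.mem_insert_of_mem hz) v hv z'
      (Finset.mem_insert_of_mem hz') v' hv'
    set B := Finset.univ.filter fun f : E → Bool => ∀ z ∈ Z, ¬ ∀ v ∈ S, f (e z v) = p v with hB
    set P : (E → Bool) → Prop := fun f => ∀ v ∈ S, f (e z v) = p v with hP
    have hsplit : (Finset.univ.filter fun f : E → Bool =>
        ∀ z' ∈ insert z Z, ¬ ∀ v ∈ S, f (e z' v) = p v) = B.filter fun f => ¬ P f := by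
      ext f
      simp only [hB, hP, Finset.mem_filter, Finset.mem_univ, true_and, Finset.forall_mem_insert]
      tauto
    -- Overwriting the values at the pairs of `z` by the pattern maps `B` into the part of `B` where
    -- `z` succeeds, with fibres of size at most `2 ^ |S|`.
    let φ : (E → Bool) → E → Bool := fun f x =>
      if h : ∃ v ∈ S, e z v = x then p h.choose else f x
    have hφ : ∀ f, ∀ v ∈ S, φ f (e z v) = p v := by
      intro f v hv
      have h : ∃ v' ∈ S, e z v' = e z v := ⟨v, hv, rfl⟩
      simp only [φ, dif_pos h]
      rw [(he z (by simp) _ h.choose_spec.1 z (by simp) v hv h.choose_spec.2).2]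
    have hφ' : ∀ f x, (∀ v ∈ S, e z v ≠ x) → φ f x = f x := by
      intro f x hx
      exact dif_neg (by push Not; exact hx)
    have hcard : B.card ≤ 2 ^ S.card * (B.filter P).card := by
      refine Finset.card_le_mul_card_image_of_maps_to (f := φ) ?_ _ ?_
      · intro f hf
        simp only [hB, hP, Finset.mem_filter, Finset.mem_univ, true_and] at hf ⊢
        refine ⟨fun z' hz' h => hf z' hz' fun v hv => ?_, hφ f⟩
        rw [← h v hv, hφ']
        intro v' hv' heq
        have := (he z (by simp) v' hv' z' (Finset.mem_insert_of_mem hz') v hv heq).1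
        exact hz (this ▸ hz')
      · intro g _
        have : (Finset.univ : Finset (S → Bool)).card = 2 ^ S.card := by simp
        rw [← this]
        refine Finset.card_le_card_of_injOn (fun f v => f (e z v)) (fun _ _ => by simp) ?_
        intro f hf f' hf' hff
        simp only [Finset.coe_filter, Set.mem_ofPred_eq] at hf hf'
        funext x
        by_cases hx : ∃ v ∈ S, e z v = x
        · obtain ⟨v, hv, rfl⟩ := hx
          exact congrFun hff ⟨v, hv⟩
        · push Not at hx
          rw [← hφ' f x hx, ← hφ' f' x hx, hf.2, hf'.2]
    have hsum := Finset.card_filter_add_card_filter_not (s := B) P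
    rw [hsplit, Finset.card_insert_of_notMem hz, pow_succ]
    have h1 : (B.card : ℝ) ≤ 2 ^ S.card * ((B.filter P).card : ℝ) := by exact_mod_cast hcard
    have h2 : ((B.filter P).card : ℝ) + ((B.filter fun f => ¬ P f).card : ℝ) = B.card := by
      exact_mod_cast hsum
    have h3 : (1 / 2 : ℝ) ^ S.card * B.card ≤ (B.filter P).card := by
      rw [one_div, inv_pow, inv_mul_le_iff₀ (by positivity)]
      exact h1
    have h4 : (1 / 2 : ℝ) ^ S.card ≤ 1 := pow_le_one₀ (by norm_num) (by norm_num)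
    calc ((B.filter fun f => ¬ P f).card : ℝ) ≤ (1 - (1 / 2) ^ S.card) * B.card := by linarith
      _ ≤ (1 - (1 / 2) ^ S.card) * ((1 - (1 / 2) ^ S.card) ^ Z.card * 2 ^ Fintype.card E) :=
        mul_le_mul_of_nonneg_left ih' (by linarith)
      _ = _ := by ring

theorem exists_mul_pow_mul_pow_lt_one (K : ℕ) (a : ℕ) (k t : ℕ) {q : ℝ} (hq : 0 ≤ q)
    (hq' : q < 1) :
    ∃ M : ℕ, 0 < M ∧ (K : ℝ) * ((a * (M + t) + 1 : ℕ) : ℝ) ^ k * q ^ M < 1 := by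
  have hlim := tendsto_pow_const_mul_const_pow_of_abs_lt_one k (r := q) (by rwa [abs_of_nonneg hq])
  set A : ℝ := K * ((a * (1 + t) + 1 : ℕ) : ℝ) ^ k with hA
  have hA0 : 0 ≤ A := by positivity
  have hev := (hlim.eventually_lt_const (show (0 : ℝ) < 1 / (A + 1) by positivity)).and
    (Filter.eventually_gt_atTop 0)
  obtain ⟨M, hM, hM0⟩ := hev.exists
  refine ⟨M, hM0, ?_⟩
  have hbase : a * (M + t) + 1 ≤ (a * (1 + t) + 1) * M := by
    have h1 : 1 ≤ M := hM0
    have h2 : t ≤ t * M := Nat.le_mul_of_pos_right t hM0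
    calc a * (M + t) + 1 ≤ a * (M + t * M) + M := by gcongr
      _ = _ := by ring
  have hbase' : ((a * (M + t) + 1 : ℕ) : ℝ) ≤ ((a * (1 + t) + 1 : ℕ) : ℝ) * M := by
    exact_mod_cast hbase
  calc (K : ℝ) * ((a * (M + t) + 1 : ℕ) : ℝ) ^ k * q ^ M
      ≤ K * (((a * (1 + t) + 1 : ℕ) : ℝ) * M) ^ k * q ^ M := by gcongr
    _ = A * ((M : ℝ) ^ k * q ^ M) := by rw [hA, mul_pow]; ring
    _ ≤ A * (1 / (A + 1)) := by gcongr
    _ < 1 := by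
      rw [mul_one_div, div_lt_one (by positivity)]
      linarith

/-- The set of values of a partial function on `Fin t`. -/
def finsetOf {V : Type} [DecidableEq V] {t : ℕ} (g : Fin t → Option V) : Finset V :=
  Finset.univ.biUnion fun i => (g i).toFinset

/-- For the union bound: sets of size at most `t` are indexed by `(|V| + 1) ^ t` codes, a polynomial
number. -/
theorem exists_finsetOf_eq {V : Type} [DecidableEq V] {t : ℕ} (S : Finset V) (hS : S.card ≤ t) :
    ∃ g : Fin t → Option V, finsetOf g = S := by
  refine ⟨fun i => if h : i.1 < S.card then some (S.equivFin.symm ⟨i.1, h⟩).1 else none, ?_⟩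
  ext v
  simp only [finsetOf, Finset.mem_biUnion, Finset.mem_univ, true_and, Option.mem_toFinset,
    Option.mem_def]
  constructor
  · rintro ⟨i, hi⟩
    split_ifs at hi with h
    simp only [Option.some.injEq] at hi
    exact hi ▸ (S.equivFin.symm ⟨i.1, h⟩).2
  · intro hv
    refine ⟨⟨S.equivFin ⟨v, hv⟩, (S.equivFin ⟨v, hv⟩).2.trans_le hS⟩, ?_⟩
    simp

theorem card_finsetOf_le {V : Type} [DecidableEq V] {t : ℕ} (g : Fin t → Option V) :
    (finsetOf g).card ≤ t := by
  refine Finset.card_biUnion_le.trans ((Finset.sum_le_card_nsmul _ _ 1 fun i _ => ?_).trans ?_)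
  · cases g i <;> simp
  · simp

end Counting

/-- The graph on `C × Fin N` in which the adjacency of vertices from the classes `c` and `d` is
`st c d` if this is prescribed, and given by `f` otherwise. -/
def blowup {C : Type} {N : ℕ} (st : C → C → Option Bool) (hst : ∀ c d, st c d = st d c)
    (f : Sym2 (C × Fin N) → Bool) : SimpleGraph (C × Fin N) where
  Adj x y := x ≠ y ∧ (st x.1 y.1).getD (f s(x, y)) = true
  symm := ⟨fun x y h => ⟨h.1.symm, by rw [hst, Sym2.eq_swap]; exact h.2⟩⟩
  loopless := ⟨fun x h => h.1 rfl⟩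

/-- In `G`, adjacencies between classes are as prescribed by `st`, and for each class `c` all
adjacencies to at most `t` vertices that are not prescribed are realized in `c`, even outside
given `t` vertices. -/
structure IsGeneric {C : Type} {N : ℕ} (st : C → C → Option Bool) (t : ℕ)
    (G : SimpleGraph (C × Fin N)) : Prop where
  adj_iff : ∀ {x y : C × Fin N} {b : Bool}, x ≠ y → st x.1 y.1 = some b → (G.Adj x y ↔ b = true)
  exists_pattern : ∀ (c : C) (S F : Finset (C × Fin N)), S.card ≤ t → F.card ≤ t →
    (∀ v ∈ S, st c v.1 = none) → ∀ p : C × Fin N → Prop,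
      ∃ z, z.1 = c ∧ z ∉ F ∧ ∀ v ∈ S, (G.Adj z v ↔ p v)

/-- A union bound over the class, the set `S`, the excluded set `F` and the pattern: polynomially
many bad events, each exponentially unlikely. Since `st c c` is prescribed, no vertex of `S` has
class `c`, so distinct choices of `(z, v)` give distinct unordered pairs. -/
theorem exists_isGeneric {C : Type} [Fintype C] (st : C → C → Option Bool)
    (hst : ∀ c d, st c d = st d c) (hself : ∀ c, st c c ≠ none) (t : ℕ) :
    ∃ (N : ℕ) (G : SimpleGraph (C × Fin N)), 0 < N ∧ IsGeneric st t G := by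
  classical
  have hq0 : (0 : ℝ) ≤ 1 - (1 / 2) ^ t :=
    sub_nonneg.2 (pow_le_one₀ (by norm_num) (by norm_num))
  have hq1 : (1 - (1 / 2) ^ t : ℝ) < 1 := sub_lt_self _ (by positivity)
  -- The exponent `3 * t` counts the codes of `S`, `F` and the pattern. With `N = M + t`, at least
  -- `M` vertices of each class remain outside `F`.
  obtain ⟨M, hM, hlt⟩ := exists_mul_pow_mul_pow_lt_one (Fintype.card C) (Fintype.card C) (3 * t) t
    hq0 hq1
  set N := M + t
  set V := C × Fin N
  let I := C × (Fin t → Option V) × (Fin t → Option V) × (Fin t → Option V)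
  let Z : I → Finset V := fun i => Finset.univ.filter fun z => z.1 = i.1 ∧ z ∉ finsetOf i.2.2.1
  let bad : I → Finset (Sym2 V → Bool) := fun i => Finset.univ.filter fun f =>
    (∀ v ∈ finsetOf i.2.1, st i.1 v.1 = none) ∧
      ∀ z ∈ Z i, ¬ ∀ v ∈ finsetOf i.2.1, f s(z, v) = decide (v ∈ finsetOf i.2.2.2)
  have hbad : ∀ i, ((bad i).card : ℝ) ≤
      (1 - (1 / 2) ^ t) ^ M * 2 ^ Fintype.card (Sym2 V) := by
    rintro ⟨c, g, h, g'⟩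
    by_cases hfree : ∀ v ∈ finsetOf g, st c v.1 = none
    · have hle := card_filter_forall_not_le (fun z v : V => s(z, v)) (finsetOf g)
        (fun v => decide (v ∈ finsetOf g')) (Z (c, g, h, g')) (by
          intro z hz v hv z' hz' v' hv' heq
          simp only [Z, Finset.mem_filter, Finset.mem_univ, true_and] at hz hz'
          rcases Sym2.eq_iff.1 heq with h | ⟨h, -⟩
          · exact h
          · exact absurd (hfree v' hv') (by rw [← h, hz.1]; exact hself c))
      have hsub : bad (c, g, h, g') = Finset.univ.filter fun f : Sym2 V → Bool =>
          ∀ z ∈ Z (c, g, h, g'), ¬ ∀ v ∈ finsetOf g, f s(z, v) = decide (v ∈ finsetOf g') := by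
        ext f
        simp only [bad, Finset.mem_filter, Finset.mem_univ, true_and]
        exact and_iff_right hfree
      have hle' : ((bad (c, g, h, g')).card : ℝ) ≤
          (1 - (1 / 2) ^ (finsetOf g).card) ^ (Z (c, g, h, g')).card *
            2 ^ Fintype.card (Sym2 V) := by
        rw [hsub]
        convert hle
      refine hle'.trans (mul_le_mul_of_nonneg_right ?_ (by positivity))
      have hZ : M ≤ (Z (c, g, h, g')).card := by
        have h1 : (Finset.univ.image fun j : Fin N => ((c, j) : V)) \ finsetOf h ⊆
            Z (c, g, h, g') := by
          intro z hz
          simp only [Finset.mem_sdiff, Finset.mem_image, Finset.mem_univ, true_and] at hz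
          obtain ⟨⟨j, rfl⟩, hz⟩ := hz
          simp [Z, hz]
        have h2 := Finset.le_card_sdiff (finsetOf h)
          (Finset.univ.image fun j : Fin N => ((c, j) : V))
        have h3 : (Finset.univ.image fun j : Fin N => ((c, j) : V)).card = N := by
          rw [Finset.card_image_of_injective _ (fun a b h => by simpa using h)]
          simp
        have h4 := card_finsetOf_le h
        have h5 := Finset.card_le_card h1
        omega
      have hS : (1 / 2 : ℝ) ^ t ≤ (1 / 2) ^ (finsetOf g).card :=
        pow_le_pow_of_le_one (by norm_num) (by norm_num) (card_finsetOf_le g)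
      have hS' : (1 / 2 : ℝ) ^ (finsetOf g).card ≤ 1 := pow_le_one₀ (by norm_num) (by norm_num)
      calc (1 - (1 / 2 : ℝ) ^ (finsetOf g).card) ^ (Z (c, g, h, g')).card
          ≤ (1 - (1 / 2 : ℝ) ^ (finsetOf g).card) ^ M :=
            pow_le_pow_of_le_one (by linarith) (sub_le_self _ (by positivity)) hZ
        _ ≤ _ := pow_le_pow_left₀ (by linarith) (by linarith) M
    · have : bad (c, g, h, g') = ∅ := by
        ext f
        simp only [bad, Finset.mem_filter, Finset.mem_univ, true_and, Finset.notMem_empty,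
          iff_false]
        exact fun h => hfree h.1
      rw [this]
      simpa using pow_nonneg hq0 M
  have hcardI : Fintype.card I = Fintype.card C * (Fintype.card C * N + 1) ^ (3 * t) := by
    simp only [I, V, Fintype.card_prod, Fintype.card_fun, Fintype.card_fin, Fintype.card_option]
    ring
  have hlt' : ((Finset.univ.biUnion bad).card : ℝ) <
      (Finset.univ : Finset (Sym2 V → Bool)).card := by
    calc ((Finset.univ.biUnion bad).card : ℝ) ≤ ∑ i, ((bad i).card : ℝ) := by
          exact_mod_cast Finset.card_biUnion_le
      _ ≤ ∑ _i : I, (1 - (1 / 2) ^ t : ℝ) ^ M * 2 ^ Fintype.card (Sym2 V) :=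
          Finset.sum_le_sum fun i _ => hbad i
      _ = ((Fintype.card C : ℝ) * ((Fintype.card C * N + 1 : ℕ) : ℝ) ^ (3 * t) *
            (1 - (1 / 2) ^ t) ^ M) * 2 ^ Fintype.card (Sym2 V) := by
          rw [Finset.sum_const, Finset.card_univ, hcardI, nsmul_eq_mul]
          push_cast
          ring
      _ < 1 * 2 ^ Fintype.card (Sym2 V) := by gcongr
      _ = _ := by simp
  obtain ⟨f, -, hf⟩ := Finset.exists_mem_notMem_of_card_lt_card (by exact_mod_cast hlt')
  refine ⟨N, blowup st hst f, by omega, ?_, ?_⟩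
  · intro x y b hxy hb
    simp [blowup, hxy, hb]
  · intro c S F hS hF hfree p
    obtain ⟨g, rfl⟩ := exists_finsetOf_eq S hS
    obtain ⟨h, rfl⟩ := exists_finsetOf_eq F hF
    obtain ⟨g', hg'⟩ := exists_finsetOf_eq ((finsetOf g).filter p)
      ((Finset.card_filter_le _ _).trans hS)
    have hfb : f ∉ bad (c, g, h, g') := fun hfb => hf (Finset.mem_biUnion.2 ⟨_, by simp, hfb⟩)
    simp only [bad, Finset.mem_filter, Finset.mem_univ, true_and, not_and] at hfb
    have := hfb hfree
    push Not at this
    obtain ⟨z, hz, hzf⟩ := this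
    simp only [Z, Finset.mem_filter, Finset.mem_univ, true_and] at hz
    refine ⟨z, hz.1, hz.2, fun v hv => ?_⟩
    have hzv : z ≠ v := by
      rintro rfl
      exact hself _ (hz.1 ▸ hfree z hv)
    have hnone : st z.1 v.1 = none := hz.1 ▸ hfree v hv
    have hfp : f s(z, v) = true ↔ p v := by
      rw [hzf v hv, decide_eq_true_eq, hg', Finset.mem_filter]
      exact and_iff_right hv
    simp only [blowup, hnone, Option.getD_none]
    exact (and_iff_right hzv).trans hfp

/-! ### Generic graphs -/

namespace IsGeneric

variable {C : Type} {N t : ℕ} {st : C → C → Option Bool} {G : SimpleGraph (C × Fin N)}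

theorem extensionProperty (hG : IsGeneric st t G) {s : ℕ} (hst : s ≤ t)
    (h : ∀ S : Finset (C × Fin N), S.card ≤ s → ∃ c, ∀ v ∈ S, st c v.1 = none) :
    ExtensionProperty s G := by
  refine extensionProperty_of_exists_pattern fun S hS p => ?_
  obtain ⟨c, hc⟩ := h S hS
  obtain ⟨z, -, hz⟩ := hG.exists_pattern c S S (hS.trans hst) (hS.trans hst) hc p
  exact ⟨z, hz⟩

theorem not_adj (hG : IsGeneric st t G) {x y : C × Fin N} (h : st x.1 y.1 = some false) :
    ¬ G.Adj x y := by
  intro hxy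
  simpa using (hG.adj_iff hxy.ne h).1 hxy

theorem adj (hG : IsGeneric st t G) {x y : C × Fin N} (hxy : x ≠ y) (h : st x.1 y.1 = some true) :
    G.Adj x y :=
  (hG.adj_iff hxy h).2 rfl

theorem injOn_part (hG : IsGeneric st t G) {Q : Type} (part : C → Q)
    (hpart : ∀ c d, part c = part d → st c d = some false) {X : Set (C × Fin N)}
    (hX : G.IsClique X) : Set.InjOn (fun x => part x.1) X := by
  intro x hx y hy hxy
  by_contra hne
  exact hG.not_adj (hpart _ _ hxy) (hX hx hy hne)

/-- A clique has at most one vertex in each part, hence at most `t` vertices. Genericity supplies a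
new `z` in `c` correct on the free adjacencies; the prescribed ones are already equal to `b`. -/
theorem exists_forall_adj_iff [Finite C] (hG : IsGeneric st t G) {Q : Type} [Fintype Q]
    (hQ : Fintype.card Q ≤ t) (part : C → Q)
    (hpart : ∀ c d, part c = part d → st c d = some false) {X : Set (C × Fin N)}
    (hX : G.IsClique X) (b : Bool) (c : C) (hc : ∀ x ∈ X, st c x.1 ≠ some (!b)) :
    ∃ z, z ∉ X ∧ ∀ x ∈ X, (G.Adj z x ↔ b = true) := by
  classical
  have := Fintype.ofFinite C
  have hcard : X.toFinset.card ≤ t := by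
    refine le_trans ?_ hQ
    rw [← Finset.card_univ]
    exact Finset.card_le_card_of_injOn (fun x => part x.1) (fun _ _ => by simp)
      (by simpa using hG.injOn_part part hpart hX)
  obtain ⟨z, hzc, hzX, hz⟩ := hG.exists_pattern c
    (X.toFinset.filter fun x => st c x.1 = none) X.toFinset
    ((Finset.card_filter_le _ _).trans hcard) hcard (by simp) (fun _ => b = true)
  rw [Set.mem_toFinset] at hzX
  refine ⟨z, hzX, fun x hx => ?_⟩
  cases h : st c x.1 with
  | none => exact hz x (by simp [hx, h])
  | some b' =>
    have hb : b' = b := by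
      have := hc x hx
      rw [h] at this
      cases b <;> cases b' <;> simp_all
    subst hb
    exact hG.adj_iff (fun hzx => hzX (hzx ▸ hx)) (hzc ▸ h)

theorem extNonAdj [Finite C] (hG : IsGeneric st t G) {Q : Type} [Fintype Q]
    (hQ : Fintype.card Q ≤ t) (part : C → Q)
    (hpart : ∀ c d, part c = part d → st c d = some false) {X : Set (C × Fin N)}
    (hX : G.IsClique X) (c : C) (hc : ∀ x ∈ X, st c x.1 ≠ some true) : ExtNonAdj G X := by
  obtain ⟨z, hz, hz'⟩ := hG.exists_forall_adj_iff hQ part hpart hX false c hc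
  exact ⟨z, hz, fun x hx => by simp [hz' x hx]⟩

theorem extAdj [Finite C] (hG : IsGeneric st t G) {Q : Type} [Fintype Q]
    (hQ : Fintype.card Q ≤ t) (part : C → Q)
    (hpart : ∀ c d, part c = part d → st c d = some false) {X : Set (C × Fin N)}
    (hX : G.IsClique X) (c : C) (hc : ∀ x ∈ X, st c x.1 ≠ some false) : ExtAdj G X := by
  obtain ⟨z, hz, hz'⟩ := hG.exists_forall_adj_iff hQ part hpart hX true c hc
  exact ⟨z, hz, fun x hx => by simp [hz' x hx]⟩

end IsGeneric

theorem exists_notMem_image_of_card_lt {α : Type} {m : ℕ} (S : Finset α) (f : α → Finset (Fin m))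
    (hf : ∀ x ∈ S, (f x).card ≤ 1) (hS : S.card < m) : ∃ i, ∀ x ∈ S, i ∉ f x := by
  classical
  by_contra! h
  have huniv : (Finset.univ : Finset (Fin m)) ⊆ S.biUnion f := fun i _ => by
    simpa using h i
  have h₁ := Finset.card_le_card huniv
  have h₂ := (Finset.card_biUnion_le (s := S) (t := f)).trans (Finset.sum_le_card_nsmul _ _ 1 hf)
  simp at h₁ h₂
  omega

/-! ### A graph without dominating cliques -/

/-- The complete multipartite prescription: only the classes are prescribed to be independent. -/
def multipartiteStatus (m : ℕ) (i j : Fin m) : Option Bool :=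
  if i = j then some false else none

/-- Any `s` vertices leave one of the `s + 1` classes free. No adjacency is prescribed to be
present, so every clique has an external vertex adjacent to none of it. -/
theorem exists_extensionProperty_phiC1 (s : ℕ) :
    ∃ (N : ℕ) (G : SimpleGraph (Fin (s + 1) × Fin N)), 0 < N ∧ ExtensionProperty s G ∧ PhiC1 G := by
  obtain ⟨N, G, hN, hG⟩ := exists_isGeneric (multipartiteStatus (s + 1))
    (fun i j => by simp [multipartiteStatus, eq_comm]) (fun i => by simp [multipartiteStatus])
    (s + 1)
  refine ⟨N, G, hN, hG.extensionProperty (Nat.le_succ s) fun S hS => ?_, fun X hX => ?_⟩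
  · obtain ⟨i, hi⟩ := exists_notMem_image_of_card_lt S (fun v => {v.1}) (by simp)
      (Nat.lt_succ_of_le hS)
    refine ⟨i, fun v hv => if_neg ?_⟩
    simpa using hi v hv
  · refine hG.extNonAdj (Q := Fin (s + 1)) (by simp) id
      (fun i j h => if_pos h) hX 0 fun x _ => ?_
    simp [multipartiteStatus]

/-! ### Graphs with dominating cliques -/

/-- The classes `ground i j`, `dominator j l` and `extra e`. -/
abbrev DomClass (m ε : ℕ) : Type := (Fin m × Fin m) ⊕ (Fin m × Fin m) ⊕ Fin ε

namespace DomClass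

variable {m ε : ℕ}

/-- The vertices of `ground i j` lie in the part `i` of the ground, and are dominated by the
part `j` of the dominators. -/
abbrev ground (i j : Fin m) : DomClass m ε := .inl (i, j)

/-- The vertices of `dominator j l` lie in the part `j` of the dominators and are labelled
by `l`. -/
abbrev dominator (j l : Fin m) : DomClass m ε := .inr (.inl (j, l))

/-- Additional vertices that cannot belong to any transversal of the dominators. -/
abbrev extra (e : Fin ε) : DomClass m ε := .inr (.inr e)

/-- The prescribed adjacencies. If `labelled` holds, then the dominators labelled by `l` are
adjacent to the part `l` of the ground, and dominators with distinct labels are not adjacent;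
otherwise labels play no role, and dominators from distinct parts are adjacent. -/
def status (labelled : Bool) : DomClass m ε → DomClass m ε → Option Bool
  | .inl (i, _), .inl (i', _) => if i = i' then some false else none
  | .inl (i, j), .inr (.inl (j', l)) =>
      if j = j' ∨ (labelled = true ∧ i = l) then some true else none
  | .inr (.inl (j', l)), .inl (i, j) =>
      if j = j' ∨ (labelled = true ∧ i = l) then some true else none
  | .inr (.inl (j, l)), .inr (.inl (j', l')) =>
      if j = j' then some false
      else if labelled = true then (if l = l' then none else some false)
      else some true
  | .inl _, .inr (.inr _) => none
  | .inr (.inr _), .inl _ => none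
  | .inr (.inr _), .inr (.inr _) => some false
  -- Part `0` keeps extra vertices out of every transversal of the dominators, while part `1` makes
  -- every transversal dominate them. Both parts exist because `m` is `s + 2` below.
  | .inr (.inl (j, _)), .inr (.inr _) =>
      if j.1 = 0 then some false else if j.1 = 1 then some true else none
  | .inr (.inr _), .inr (.inl (j, _)) =>
      if j.1 = 0 then some false else if j.1 = 1 then some true else none

theorem status_comm (labelled : Bool) (c d : DomClass m ε) :
    status labelled c d = status labelled d c := by
  rcases c with ⟨i, j⟩ | ⟨j, l⟩ | e <;> rcases d with ⟨i', j'⟩ | ⟨j', l'⟩ | e' <;>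
    simp only [status, eq_comm]

theorem status_self (labelled : Bool) (c : DomClass m ε) :
    status labelled c c = some false := by
  rcases c with ⟨i, j⟩ | ⟨j, l⟩ | e <;> simp [status]

/-- The part to which a class belongs. -/
def part : DomClass m ε → Fin m ⊕ Fin m ⊕ Unit
  | .inl (i, _) => .inl i
  | .inr (.inl (j, _)) => .inr (.inl j)
  | .inr (.inr _) => .inr (.inr ())

theorem status_of_part_eq (labelled : Bool) (c d : DomClass m ε) (h : part c = part d) :
    status labelled c d = some false := by
  rcases c with ⟨i, j⟩ | ⟨j, l⟩ | e <;> rcases d with ⟨i', j'⟩ | ⟨j', l'⟩ | e' <;>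
    simp_all [status, part]

end DomClass

section Domination

open DomClass

variable {s ε N : ℕ} {labelled : Bool} {G : SimpleGraph (DomClass (s + 2) ε × Fin N)}
  {X : Set (DomClass (s + 2) ε × Fin N)}

/-- `X` meets all parts of the dominators. -/
def MeetsDominators (X : Set (DomClass (s + 2) ε × Fin N)) : Prop :=
  ∀ j, ∃ x ∈ X, ∃ l, x.1 = dominator j l

/-- `X` meets all parts of the ground. -/
def MeetsGround (X : Set (DomClass (s + 2) ε × Fin N)) : Prop :=
  ∀ i, ∃ x ∈ X, ∃ j, x.1 = ground i j

/-- Genericity to the degree that is needed to extend cliques. -/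
abbrev IsDomGeneric (labelled : Bool) (G : SimpleGraph (DomClass (s + 2) ε × Fin N)) : Prop :=
  IsGeneric (status labelled) (2 * s + 5) G

theorem card_parts_le : Fintype.card (Fin (s + 2) ⊕ Fin (s + 2) ⊕ Unit) ≤ 2 * s + 5 := by
  simp
  omega

theorem extNonAdj_of_class (hG : IsDomGeneric labelled G) (hX : G.IsClique X)
    (c : DomClass (s + 2) ε) (hc : ∀ x ∈ X, status labelled c x.1 ≠ some true) : ExtNonAdj G X :=
  hG.extNonAdj card_parts_le part (status_of_part_eq labelled) hX c hc

theorem extAdj_of_class (hG : IsDomGeneric labelled G) (hX : G.IsClique X)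
    (c : DomClass (s + 2) ε) (hc : ∀ x ∈ X, status labelled c x.1 ≠ some false) : ExtAdj G X :=
  hG.extAdj card_parts_le part (status_of_part_eq labelled) hX c hc

/-- Given `s` vertices, a class `ground i j` has no prescription towards them if `i` avoids their
ground parts and labels and `j` avoids their dominator parts. -/
theorem extensionProperty_of_isDomGeneric (hG : IsDomGeneric labelled G) :
    ExtensionProperty s G := by
  refine hG.extensionProperty (by omega) fun S hS => ?_
  obtain ⟨i, hi⟩ := exists_notMem_image_of_card_lt (m := s + 2) S (fun v =>
    match v.1 with
    | .inl (i, _) => {i}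
    | .inr (.inl (_, l)) => {l}
    | .inr (.inr _) => ∅)
    (by rintro ⟨⟨i, j⟩ | ⟨j, l⟩ | e, n⟩ - <;> simp) (by omega)
  obtain ⟨j, hj⟩ := exists_notMem_image_of_card_lt (m := s + 2) S (fun v =>
    match v.1 with
    | .inr (.inl (j, _)) => {j}
    | _ => ∅)
    (by rintro ⟨⟨i, j⟩ | ⟨j, l⟩ | e, n⟩ - <;> simp) (by omega)
  refine ⟨ground i j, ?_⟩
  rintro ⟨⟨i', j'⟩ | ⟨j', l'⟩ | e, n⟩ hv
  · have := hi _ hv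
    simpa [status] using this
  · have h₁ := hi _ hv
    have h₂ := hj _ hv
    simp only [Finset.mem_singleton] at h₁ h₂
    simp [status, h₁, h₂]
  · simp [status]

theorem exists_label (hG : IsDomGeneric true G) (hX : G.IsClique X) :
    ∃ l₀, ∀ x ∈ X, ∀ j l, x.1 = dominator j l → l = l₀ := by
  by_cases h : ∃ x ∈ X, ∃ j l, x.1 = dominator j l
  · obtain ⟨x, hx, j, l, hxl⟩ := h
    refine ⟨l, fun y hy j' l' hyl => ?_⟩
    by_cases hxy : y = x
    · subst hxy
      rw [hxl] at hyl
      simp_all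
    · by_contra hne
      refine hG.not_adj ?_ (hX hy hx hxy)
      rw [hxl, hyl]
      simp [status, hne]
  · push Not at h
    exact ⟨0, fun x hx j l hxl => absurd hxl (h x hx j l)⟩

/-- If part `j` is missed, `ground i j` has no prescribed adjacency to `X`, where in the labelled
case `i` differs from the common label of the dominators in `X`. -/
theorem meetsDominators_of_not_extNonAdj (hG : IsDomGeneric labelled G) (hX : G.IsClique X)
    (h : ¬ ExtNonAdj G X) : MeetsDominators X := by
  intro j
  by_contra! hj
  obtain ⟨i, hi⟩ : ∃ i, labelled = true → ∀ x ∈ X, ∀ j l, x.1 = dominator j l → i ≠ l := by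
    cases labelled with
    | false => exact ⟨0, by simp⟩
    | true =>
      obtain ⟨l₀, hl₀⟩ := exists_label hG hX
      obtain ⟨i, hi⟩ := exists_ne l₀
      exact ⟨i, fun _ x hx j l hxl => by rwa [hl₀ x hx j l hxl]⟩
  refine h (extNonAdj_of_class hG hX (ground i j) ?_)
  rintro ⟨⟨i', j'⟩ | ⟨j', l'⟩ | e, n⟩ hx
  · simp [status]
  · have h₁ : j ≠ j' := fun h => hj _ hx l' (by simp [h])
    have h₂ : labelled = true → i ≠ l' := fun h => hi h _ hx j' l' rfl
    simp only [status, ne_eq, ite_eq_left_iff, reduceCtorEq, imp_false, not_not]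
    tauto
  · simp [status]

theorem not_mem_extra_of_meetsDominators (hG : IsDomGeneric labelled G) (hX : G.IsClique X)
    (h : MeetsDominators X) (e : Fin ε) (n : Fin N) : ((extra e, n) : _ × Fin N) ∉ X := by
  intro he
  obtain ⟨x, hx, l, hxl⟩ := h 0
  refine hG.not_adj (x := x) (y := (extra e, n)) (by simp [hxl, status]) (hX hx he ?_)
  rintro rfl
  simp at hxl

/-- If ground part `i` is missed, `X` has fewer ground vertices than there are indices, so some `j`
is not the second index of any of them. Then `dominator j i` has no prescribed adjacency to `X`. -/
theorem meetsGround_of_not_extNonAdj (hG : IsDomGeneric true G) (hX : G.IsClique X)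
    (h : ¬ ExtNonAdj G X) : MeetsGround X := by
  intro i
  by_contra! hi
  have hdom := meetsDominators_of_not_extNonAdj hG hX h
  obtain ⟨j, hj⟩ : ∃ j, ∀ x ∈ X, ∀ i', x.1 ≠ ground i' j := by
    by_contra! hall
    choose x hx f hf using hall
    have hinj : Function.Injective f := by
      intro j j' hjj
      have := hG.injOn_part part (status_of_part_eq true) hX (hx j) (hx j')
        (by simp [hf, part, hjj])
      have h' := hf j
      rw [this, hf j'] at h'
      simp_all
    obtain ⟨j, rfl⟩ := Finite.surjective_of_injective hinj i
    exact hi _ (hx j) _ (hf j)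
  refine h (extNonAdj_of_class hG hX (dominator j i) ?_)
  rintro ⟨⟨i', j'⟩ | ⟨j', l'⟩ | e, n⟩ hx
  · have h₁ : j' ≠ j := fun h => hj _ hx i' (by simp [h])
    have h₂ : i' ≠ i := fun h => hi _ hx j' (by simp [h])
    simp [status, h₁, h₂]
  · simp only [status]
    split_ifs <;> simp
  · exact absurd hx (not_mem_extra_of_meetsDominators hG hX hdom e n)

theorem meetsGround_of_not_extAdj (hG : IsDomGeneric labelled G) (hX : G.IsClique X)
    (h : ¬ ExtAdj G X) : MeetsGround X := by
  intro i
  by_contra! hi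
  refine h (extAdj_of_class hG hX (ground i 0) ?_)
  rintro ⟨⟨i', j'⟩ | ⟨j', l'⟩ | e, n⟩ hx
  · have : i ≠ i' := fun h => hi _ hx j' (by simp [h])
    simp [status, this]
  · simp [status]
  · simp [status]

/-- A missed part `j` leaves room for a vertex of `dominator j l₀` with the common label `l₀`; only
extra vertices could forbid it. -/
theorem meetsDominators_of_not_extAdj (hG : IsDomGeneric labelled G) (hX : G.IsClique X)
    (hextra : ∀ e n, ((extra e, n) : _ × Fin N) ∉ X) (h : ¬ ExtAdj G X) : MeetsDominators X := by
  intro j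
  by_contra! hj
  obtain ⟨l₀, hl₀⟩ : ∃ l₀, labelled = true → ∀ x ∈ X, ∀ j l, x.1 = dominator j l → l = l₀ := by
    cases labelled with
    | false => exact ⟨0, by simp⟩
    | true =>
      obtain ⟨l₀, hl₀⟩ := exists_label hG hX
      exact ⟨l₀, fun _ => hl₀⟩
  refine h (extAdj_of_class hG hX (dominator j l₀) ?_)
  rintro ⟨⟨i', j'⟩ | ⟨j', l'⟩ | e, n⟩ hx
  · simp [status]
  · have h₁ : j ≠ j' := fun h => hj _ hx l' (by simp [h])
    have h₂ : labelled = true → l₀ = l' := fun h => (hl₀ h _ hx j' l' rfl).symm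
    simp only [status, if_neg h₁]
    split_ifs <;> simp_all
  · exact absurd hx (hextra e n)

theorem not_extAdj_of_meets (hG : IsDomGeneric labelled G) (h : MeetsDominators X)
    (h' : MeetsGround X) : ¬ ExtAdj G X := by
  rintro ⟨⟨⟨i, j⟩ | ⟨j, l⟩ | e, n⟩, hz, hadj⟩
  · obtain ⟨x, hx, j', hxj⟩ := h' i
    exact hG.not_adj (by simp [hxj, status]) (hadj x hx)
  · obtain ⟨x, hx, l', hxl⟩ := h j
    exact hG.not_adj (by simp [hxl, status]) (hadj x hx)
  · obtain ⟨x, hx, l', hxl⟩ := h 0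
    exact hG.not_adj (by simp [hxl, status]) (hadj x hx)

theorem not_extNonAdj_of_meets (hG : IsDomGeneric labelled G) (h : MeetsDominators X)
    (h' : labelled = true → MeetsGround X) : ¬ ExtNonAdj G X := by
  rintro ⟨⟨⟨i, j⟩ | ⟨j, l⟩ | e, n⟩, hz, hadj⟩
  · obtain ⟨x, hx, l, hxl⟩ := h j
    exact hadj x hx (hG.adj (fun h => hz (h ▸ hx)) (by simp [hxl, status]))
  · cases labelled with
    | true =>
      obtain ⟨x, hx, j', hxj⟩ := h' rfl l
      exact hadj x hx (hG.adj (fun h => hz (h ▸ hx)) (by simp [hxj, status]))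
    | false =>
      obtain ⟨j', hj'⟩ := exists_ne j
      obtain ⟨x, hx, l', hxl⟩ := h j'
      exact hadj x hx (hG.adj (fun h => hz (h ▸ hx)) (by simp [hxl, status, hj'.symm]))
  · obtain ⟨x, hx, l', hxl⟩ := h 1
    exact hadj x hx (hG.adj (fun h => hz (h ▸ hx)) (by simp [hxl, status]))

theorem phiC2_of_isDomGeneric {G : SimpleGraph (DomClass (s + 2) 0 × Fin N)}
    (hG : IsDomGeneric labelled G) : PhiC2 G := fun _ hX =>
  not_extNonAdj_of_meets hG (meetsDominators_of_not_extAdj hG hX.1 (fun e => e.elim0) hX.2)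
    fun _ => meetsGround_of_not_extAdj hG hX.1 hX.2

/-- A maximal clique through an extra vertex misses part `0` of the dominators, hence does not
dominate. -/
theorem not_phiC2_of_isDomGeneric {G : SimpleGraph (DomClass (s + 2) 1 × Fin N)} (hN : 0 < N)
    (hG : IsDomGeneric labelled G) : ¬ PhiC2 G := by
  intro h
  obtain ⟨X, heX, hX⟩ := exists_maxClique_superset (G := G)
    (X := {((extra 0, ⟨0, hN⟩) : DomClass (s + 2) 1 × Fin N)}) (by simp)
  exact not_mem_extra_of_meetsDominators hG hX.1
    (meetsDominators_of_not_extNonAdj hG hX.1 (h X hX)) 0 ⟨0, hN⟩ (heX rfl)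

theorem phiC3_of_isDomGeneric (hG : IsDomGeneric true G) : PhiC3 G := fun _ hX =>
  ⟨hX.1, not_extAdj_of_meets hG (meetsDominators_of_not_extNonAdj hG hX.1 hX.2)
    (meetsGround_of_not_extNonAdj hG hX.1 hX.2)⟩

/-- Starting from a dominator in part `0` keeps extra vertices out of the maximal clique, which
therefore meets all parts and dominates. -/
theorem not_phiC1_of_isDomGeneric_true (hN : 0 < N) (hG : IsDomGeneric true G) : ¬ PhiC1 G := by
  intro h
  obtain ⟨X, hkX, hX⟩ := exists_maxClique_superset (G := G)
    (X := {((dominator 0 0, ⟨0, hN⟩) : DomClass (s + 2) ε × Fin N)}) (by simp)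
  refine not_extNonAdj_of_meets hG (meetsDominators_of_not_extAdj hG hX.1 (fun e n he => ?_) hX.2)
    (fun _ => meetsGround_of_not_extAdj hG hX.1 hX.2) (h X hX.1)
  exact hG.not_adj (x := (dominator 0 0, ⟨0, hN⟩)) (y := (extra e, n)) (by simp [status])
    (hX.1 (hkX rfl) he (by simp))

/-- A transversal of the dominators is a dominating clique, and ground vertices can still be added
to it. -/
theorem exists_isClique_of_isDomGeneric_false (hN : 0 < N) (hG : IsDomGeneric false G) :
    ∃ X, G.IsClique X ∧ ¬ ExtNonAdj G X ∧ ExtAdj G X := by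
  let f : Fin (s + 2) → DomClass (s + 2) ε × Fin N := fun j => (dominator j 0, ⟨0, hN⟩)
  have hclique : G.IsClique (Set.range f) := by
    rintro _ ⟨j, rfl⟩ _ ⟨j', rfl⟩ hne
    have : j ≠ j' := fun h => hne (h ▸ rfl)
    exact hG.adj hne (by simp [f, status, this])
  refine ⟨Set.range f, hclique, ?_, ?_⟩
  · exact not_extNonAdj_of_meets hG (fun j => ⟨f j, ⟨j, rfl⟩, 0, rfl⟩) (by simp)
  · by_contra h
    obtain ⟨_, ⟨j, rfl⟩, j', h'⟩ := meetsGround_of_not_extAdj hG hclique h 0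
    simp [f] at h'

theorem exists_isDomGeneric (s ε : ℕ) (labelled : Bool) :
    ∃ (N : ℕ) (G : SimpleGraph (DomClass (s + 2) ε × Fin N)), 0 < N ∧ IsDomGeneric labelled G :=
  exists_isGeneric (status labelled) (status_comm labelled)
    (fun c => by simp [status_self]) (2 * s + 5)

end Domination

/-! ### Transport to `Fin n` and to complements -/

section Transport

variable {V : Type u} {W : Type v} {G : SimpleGraph V} {H : SimpleGraph W}

theorem isClique_preimage_iff (φ : G ≃g H) (X : Set W) :
    G.IsClique (φ ⁻¹' X) ↔ H.IsClique X := by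
  constructor
  · intro h x hx y hy hxy
    obtain ⟨x, rfl⟩ := φ.surjective x
    obtain ⟨y, rfl⟩ := φ.surjective y
    exact φ.map_adj_iff.2 (h hx hy fun h => hxy (h ▸ rfl))
  · intro h x hx y hy hxy
    exact φ.map_adj_iff.1 (h hx hy (φ.injective.ne hxy))

theorem extNonAdj_preimage_iff (φ : G ≃g H) (X : Set W) :
    ExtNonAdj G (φ ⁻¹' X) ↔ ExtNonAdj H X := by
  rw [ExtNonAdj, ExtNonAdj, φ.surjective.exists]
  simp only [φ.surjective.forall, Set.mem_preimage, φ.map_adj_iff]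

theorem extAdj_preimage_iff (φ : G ≃g H) (X : Set W) :
    ExtAdj G (φ ⁻¹' X) ↔ ExtAdj H X := by
  rw [ExtAdj, ExtAdj, φ.surjective.exists]
  simp only [φ.surjective.forall, Set.mem_preimage, φ.map_adj_iff]

theorem maxClique_preimage_iff (φ : G ≃g H) (X : Set W) :
    MaxClique G (φ ⁻¹' X) ↔ MaxClique H X :=
  and_congr (isClique_preimage_iff φ X) (not_congr (extAdj_preimage_iff φ X))

theorem phiC1_congr (φ : G ≃g H) : PhiC1 G ↔ PhiC1 H := by
  rw [PhiC1, PhiC1, (Set.preimage_surjective.2 φ.injective).forall]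
  simp only [isClique_preimage_iff, extNonAdj_preimage_iff]

theorem phiC2_congr (φ : G ≃g H) : PhiC2 G ↔ PhiC2 H := by
  rw [PhiC2, PhiC2, (Set.preimage_surjective.2 φ.injective).forall]
  simp only [maxClique_preimage_iff, extNonAdj_preimage_iff]

theorem phiC3_congr (φ : G ≃g H) : PhiC3 G ↔ PhiC3 H := by
  rw [PhiC3, PhiC3, (Set.preimage_surjective.2 φ.injective).forall]
  simp only [isClique_preimage_iff, maxClique_preimage_iff, extNonAdj_preimage_iff]

theorem ExtensionProperty.congr {k : ℕ} (hG : ExtensionProperty k G) (φ : G ≃g H) :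
    ExtensionProperty k H := by
  intro a b hab v w hvw
  obtain ⟨z, hz, hz'⟩ := hG a b hab (fun i => φ.symm (v i)) (fun j => φ.symm (w j))
    (fun i j h => hvw i j (φ.symm.injective h))
  refine ⟨φ z, fun i => ?_, fun j => ⟨?_, ?_⟩⟩
  · simpa using φ.map_adj_iff.2 (hz i)
  · intro h
    refine (hz' j).1 (φ.map_adj_iff.1 ?_)
    simpa using h
  · intro h
    exact (hz' j).2 (by simp [← h])

/-- A finite example for the sentences on cliques yields examples on `Fin n` for the sentences on
cliques and, by complementation, for those on independent sets. -/
theorem exists_fin_of_fiveCases [Finite V] [Nonempty V] {k : ℕ} {i : Fin 5}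
    (hG : ExtensionProperty k G) (h : FiveCases (PhiC1 G) (PhiC2 G) (PhiC3 G) i) :
    (∃ (n : ℕ) (H : SimpleGraph (Fin n)), 0 < n ∧ ExtensionProperty k H ∧
        FiveCases (PhiC1 H) (PhiC2 H) (PhiC3 H) i) ∧
      ∃ (n : ℕ) (H : SimpleGraph (Fin n)), 0 < n ∧ ExtensionProperty k H ∧
        FiveCases (PhiI1 H) (PhiI2 H) (PhiI3 H) i := by
  obtain ⟨n, ⟨e⟩⟩ := Finite.exists_equiv_fin V
  have hn : Nonempty (Fin n) := e.nonempty_congr.1 ‹_›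
  have hpos : 0 < n := Fin.pos_iff_nonempty.2 hn
  let φ : G.comap e.symm ≃g G := SimpleGraph.Iso.comap e.symm G
  have hext : ExtensionProperty k (G.comap e.symm) := hG.congr φ.symm
  rw [← propext (phiC1_congr φ), ← propext (phiC2_congr φ), ← propext (phiC3_congr φ)] at h
  refine ⟨⟨n, G.comap e.symm, hpos, hext, h⟩, n, (G.comap e.symm)ᶜ, hpos, hext.compl, ?_⟩
  rwa [propext phiI1_iff, propext phiI2_iff, propext phiI3_iff, compl_compl]

end Transport

end MonadicGraph

open MonadicGraph in
theorem theorem4 :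
    (∃ s : ℕ, 0 < s ∧
      ∀ (V : Type*) (W : Type*) [Nonempty V] [Nonempty W]
        (G : SimpleGraph V) (H : SimpleGraph W),
        ExtensionProperty s G → ExtensionProperty s H →
        (PhiC1 G ↔ PhiC1 H) → (PhiC2 G ↔ PhiC2 H) → (PhiC3 G ↔ PhiC3 H) →
        (PhiI1 G ↔ PhiI1 H) → (PhiI2 G ↔ PhiI2 H) → (PhiI3 G ↔ PhiI3 H) →
        ∀ Ψ : E12Sentence, Ψ.Holds G ↔ Ψ.Holds H) ∧
    (∀ s : ℕ, 0 < s → ∀ i : Fin 5,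
      (∃ (n : ℕ) (G : SimpleGraph (Fin n)), 0 < n ∧ ExtensionProperty s G ∧
        FiveCases (PhiC1 G) (PhiC2 G) (PhiC3 G) i) ∧
      (∃ (n : ℕ) (G : SimpleGraph (Fin n)), 0 < n ∧ ExtensionProperty s G ∧
        FiveCases (PhiI1 G) (PhiI2 G) (PhiI3 G) i)) := by
  -- The value `4` allows shapes with three parameters and one further vertex.
  refine ⟨⟨4, by norm_num, fun V W _ _ G H hG hH hC₁ hC₂ hC₃ hI₁ hI₂ hI₃ Ψ =>
    holds_iff_of_phi_iff hG hH le_rfl hC₁ hC₂ hC₃ hI₁ hI₂ hI₃ Ψ⟩, fun s _ i => ?_⟩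
  have hne : ∀ {ε N : ℕ}, 0 < N → Nonempty (DomClass (s + 2) ε × Fin N) := fun hN =>
    ⟨(DomClass.ground 0 0, ⟨0, hN⟩)⟩
  -- After the first case, the presence of an extra class decides `PhiC2` and the presence of labels
  -- decides `PhiC3`.
  fin_cases i
  · obtain ⟨N, G, hN, hG, h⟩ := exists_extensionProperty_phiC1 s
    have : Nonempty (Fin (s + 1) × Fin N) := ⟨(0, ⟨0, hN⟩)⟩
    exact exists_fin_of_fiveCases hG h
  · obtain ⟨N, G, hN, hG⟩ := exists_isDomGeneric s 1 true
    have := hne (ε := 1) hN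
    exact exists_fin_of_fiveCases (extensionProperty_of_isDomGeneric hG)
      ⟨not_phiC1_of_isDomGeneric_true hN hG, not_phiC2_of_isDomGeneric hN hG,
        phiC3_of_isDomGeneric hG⟩
  · obtain ⟨N, G, hN, hG⟩ := exists_isDomGeneric s 1 false
    have := hne (ε := 1) hN
    obtain ⟨X, hX, hX', hadj⟩ := exists_isClique_of_isDomGeneric_false hN hG
    exact exists_fin_of_fiveCases (extensionProperty_of_isDomGeneric hG)
      ⟨fun h => hX' (h X hX), not_phiC2_of_isDomGeneric hN hG, fun h => (h X ⟨hX, hX'⟩).2 hadj⟩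
  · obtain ⟨N, G, hN, hG⟩ := exists_isDomGeneric s 0 true
    have := hne (ε := 0) hN
    exact exists_fin_of_fiveCases (extensionProperty_of_isDomGeneric hG)
      ⟨phiC2_of_isDomGeneric hG, phiC3_of_isDomGeneric hG⟩
  · obtain ⟨N, G, hN, hG⟩ := exists_isDomGeneric s 0 false
    have := hne (ε := 0) hN
    obtain ⟨X, hX, hX', hadj⟩ := exists_isClique_of_isDomGeneric_false hN hG
    exact exists_fin_of_fiveCases (extensionProperty_of_isDomGeneric hG)
      ⟨phiC2_of_isDomGeneric hG, fun h => (h X ⟨hX, hX'⟩).2 hadj⟩
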